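/- Let $p\ge 0$ and $[p]=\{1,\dots,p\}$. A graph on $[p]$ is a set $E$ of ordered pairs of distinct vertices. Write $a\to b\in G$ (arrow) if $(a,b)\in E$ and $(b,a)\notin E$, and $a - b\in G$ (line) if $(a,b),(b,a)\in E$; $a,b$ are adjacent if $(a,b)\in E$ or $(b,a)\in E$; inclusions and unions of graphs are those of the edge sets; $G+(a,b)$ adds the pair $(a,b)$ to the edge set. A DAG is a graph without lines and without directed cycles; $\mathrm{pa}_D(a)$ is the set of parents of $a$. For $I\subseteq[p]$ let $D^{(I)}$ be $D$ without the edges that point to a vertex of $I$. For each $i\in[p]$ let $(\mathcal X_i,\mathcal A_i,\mu_i)$ be a $\sigma$-finite measure space with two disjoint measurable sets of positive measure. Densities on $\mathcal X=\prod_i\mathcal X_i$ are taken with respect to $\mu=\bigotimes_i\mu_i$, and equations between (conditional) densities are understood $\mu$-almost everywhere. Let $\mathcal M(D)$ be the set of strictly positive probability densities $f$ with $f(x)=\prod_a f(x_a\mid x_{\mathrm{pa}_D(a)})$. Let $\mathcal I$ be a conservative family of targets, that is, a family (repetitions allowed) of subsets of $[p]$ such that every $a\in[p]$ lies outside some $I\in\mathcal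 I$. Let $\mathcal M_{\mathcal I}(D)$ be the set of tuples $(f^{(I)})_{I\in\mathcal I}$ with $f^{(I)}\in\mathcal M(D^{(I)})$ for all $I\in\mathcal I$ and $f^{(I)}(x_a\mid x_{\mathrm{pa}_D(a)})=f^{(J)}(x_a\mid x_{\mathrm{pa}_D(a)})$ for all $I,J\in\mathcal I$ and $a\notin I\cup J$. DAGs $D_1,D_2$ are $\mathcal I$-Markov equivalent if $\mathcal M_{\mathcal I}(D_1)=\mathcal M_{\mathcal I}(D_2)$. The $\mathcal I$-essential graph $\mathcal E_{\mathcal I}(D)$ of a DAG $D$ is the union of all DAGs that are $\mathcal I$-Markov equivalent to $D$. A partial $\mathcal I$-essential graph of $D$ is a graph $G$ with $D\subseteq G\subseteq\mathcal E_{\mathcal I}(D)$ that has no induced subgraph of the form $a\to b - c$. An arrow $a\to b$ of a graph $G$ is strongly $\mathcal I$-protected in $G$ if $|I\cap\{a,b\}|=1$ for some $I\in\mathcal I$, or if there are further, pairwise distinct vertices with one of the following properties: (a) $c\to a\in G$, with $c,b$ not adjacent; (b) $c\to b\in G$, with $c,a$ not adjacent; (c) $a\to c\in G$ and $c\to b\in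 G$; (d) $a - c_1$, $a - c_2$, $c_1\to b$, $c_2\to b\in G$, with $c_1,c_2$ not adjacent. Let $D$ be a DAG on $[p]$. 1. There is exactly one partial $\mathcal I$-essential graph of $D$ in which every arrow is strongly $\mathcal I$-protected, namely $\mathcal E_{\mathcal I}(D)$. 2. If $G$ is a partial $\mathcal I$-essential graph of $D$ and the arrow $a\to b\in G$ is not strongly $\mathcal I$-protected in $G$, then $G+(b,a)$ (the arrow is replaced by a line) is again a partial $\mathcal I$-essential graph of $D$. 3. Consequently, consider the algorithm ReplaceUnprotected: as long as $G$ has an arrow $a\to b$ that is not strongly $\mathcal I$-protected in $G$, choose one and replace $G$ by $G+(b,a)$; then return $G$. Started with any partial $\mathcal I$-essential graph $G$ of $D$, and however the arrows are chosen, it passes through partial $\mathcal I$-essential graphs of $D$ only, stops after at most as many iterations as the initial graph $G$ has arrows, and returns $\mathcal E_{\mathcal I}(D)$. -/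

import Mathlib

open MeasureTheory
open scoped ENNReal

/-- A graph on the vertex set `[p]` (here `Fin p`): a set of ordered pairs of distinct vertices. -/
@[ext]
structure MixedGraph (p : ℕ) where
  Edge : Fin p → Fin p → Prop
  ne_of_edge : ∀ a b, Edge a b → a ≠ b

namespace MixedGraph

variable {p : ℕ}

/-- `a → b ∈ G`. -/
def Arrow (G : MixedGraph p) (a b : Fin p) : Prop := G.Edge a b ∧ ¬ G.Edge b a

/-- `a — b ∈ G`. -/
def Line (G : MixedGraph p) (a b : Fin p) : Prop := G.Edge a b ∧ G.Edge b a

/-- `a` and `b` are adjacent in `G`. -/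
def Adjacent (G : MixedGraph p) (a b : Fin p) : Prop := G.Edge a b ∨ G.Edge b a

theorem Arrow.ne {G : MixedGraph p} {a b : Fin p} (h : G.Arrow a b) : a ≠ b :=
  G.ne_of_edge a b h.1

/-- `G ⊆ H`, for graphs on the same vertex set. -/
instance : LE (MixedGraph p) := ⟨fun G H => ∀ a b, G.Edge a b → H.Edge a b⟩

/-- `G + (a, b)`: the ordered pair `(a, b)` is added to the edge set. -/
def addEdge (G : MixedGraph p) (a b : Fin p) (hab : a ≠ b) : MixedGraph p where
  Edge x y := G.Edge x y ∨ (x = a ∧ y = b)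
  ne_of_edge := by
    rintro x y (h | ⟨rfl, rfl⟩)
    · exact G.ne_of_edge x y h
    · exact hab

open Classical in
/-- The set of parents of `a`. -/
noncomputable def parents (G : MixedGraph p) (a : Fin p) : Finset (Fin p) :=
  Finset.univ.filter fun b => G.Arrow b a

open Classical in
/-- The number of arrows of `G`. -/
noncomputable def numArrows (G : MixedGraph p) : ℕ :=
  (Finset.univ.filter fun e : Fin p × Fin p => G.Arrow e.1 e.2).card

/-- `G` is a directed acyclic graph: all edges are arrows, and there is no cycle of arrows. -/
def IsDAG (G : MixedGraph p) : Prop :=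
  (∀ a b, G.Edge a b → G.Arrow a b) ∧ ∀ a, ¬ Relation.TransGen G.Edge a a

/-- The intervention graph `D^(I)`: all edges pointing into `I` are removed. -/
def intervene (D : MixedGraph p) (I : Finset (Fin p)) : MixedGraph p where
  Edge a b := D.Edge a b ∧ b ∉ I
  ne_of_edge a b h := D.ne_of_edge a b h.1

end MixedGraph

section Densities

variable {p : ℕ} {X : Fin p → Type*} [∀ i, MeasurableSpace (X i)]

/-- The strictly positive probability densities w.r.t. the product measure of the `μ i`. -/
def PositiveDensities (μ : ∀ i, Measure (X i)) : Set ((∀ i, X i) → ℝ≥0∞) :=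
  {f | Measurable f ∧ (∀ x, 0 < f x ∧ f x < ∞) ∧ ∫⁻ x, f x ∂(Measure.pi μ) = 1}

/-- The marginal density `f(x_A)`, as a function of `x` which depends on `x_A` only: all
coordinates outside `A` are integrated out. -/
noncomputable def marginalDensity (μ : ∀ i, Measure (X i)) (f : (∀ i, X i) → ℝ≥0∞)
    (A : Finset (Fin p)) (x : ∀ i, X i) : ℝ≥0∞ :=
  lmarginal μ Aᶜ f x

/-- The conditional density `f(x_a | x_S)`. -/
noncomputable def condDensity (μ : ∀ i, Measure (X i)) (f : (∀ i, X i) → ℝ≥0∞)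
    (a : Fin p) (S : Finset (Fin p)) (x : ∀ i, X i) : ℝ≥0∞ :=
  marginalDensity μ f (insert a S) x / marginalDensity μ f S x

/-- The positive densities which obey the Markov property of `D`, that is, which factorize as
`f(x) = ∏ a, f(x_a | x_{pa_D(a)})`. Equations between densities hold almost everywhere. -/
def MarkovDensities (μ : ∀ i, Measure (X i)) (D : MixedGraph p) : Set ((∀ i, X i) → ℝ≥0∞) :=
  {f | f ∈ PositiveDensities μ ∧
    f =ᵐ[Measure.pi μ] fun x => ∏ a, condDensity μ f a (D.parents a) x}

variable {ι : Type*}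

/-- A family of intervention targets `(T j)_j` is conservative if every vertex lies outside
some target. -/
def IsConservative (T : ι → Finset (Fin p)) : Prop := ∀ a, ∃ j, a ∉ T j

/-- The tuples of interventional densities, indexed by the family of targets `T`: the density
belonging to the target `I` obeys the Markov property of `D^(I)`, and the densities of the
targets `I` and `J` have the same conditionals `f(x_a | x_{pa_D(a)})` for all `a ∉ I ∪ J`. -/
def InterventionalDensities (μ : ∀ i, Measure (X i)) (T : ι → Finset (Fin p))
    (D : MixedGraph p) : Set (ι → (∀ i, X i) → ℝ≥0∞) :=
  {f | (∀ j, f j ∈ MarkovDensities μ (D.intervene (T j))) ∧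
    ∀ j k, ∀ a, a ∉ T j ∪ T k →
      condDensity μ (f j) a (D.parents a) =ᵐ[Measure.pi μ] condDensity μ (f k) a (D.parents a)}

/-- Interventional Markov equivalence of two DAGs w.r.t. the family of targets `T`. -/
def InterventionallyEquivalent (μ : ∀ i, Measure (X i)) (T : ι → Finset (Fin p))
    (D₁ D₂ : MixedGraph p) : Prop :=
  InterventionalDensities μ T D₁ = InterventionalDensities μ T D₂

/-- The interventional essential graph of `D`: the union of all DAGs which are interventionally
Markov equivalent to `D`. -/
def essentialGraph (μ : ∀ i, Measure (X i)) (T : ι → Finset (Fin p)) (D : MixedGraph p) :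
    MixedGraph p where
  Edge a b := ∃ D' : MixedGraph p, D'.IsDAG ∧ InterventionallyEquivalent μ T D' D ∧ D'.Edge a b
  ne_of_edge := by
    rintro a b ⟨D', -, -, h⟩
    exact D'.ne_of_edge a b h

/-- `G` is a partial interventional essential graph of `D`: `D ⊆ G ⊆ essentialGraph μ T D`, and
`a → b — c` does not occur as an induced subgraph of `G`. -/
def IsPartialEssential (μ : ∀ i, Measure (X i)) (T : ι → Finset (Fin p))
    (D G : MixedGraph p) : Prop :=
  D ≤ G ∧ G ≤ essentialGraph μ T D ∧
    ¬ ∃ a b c, G.Arrow a b ∧ G.Line b c ∧ ¬ G.Adjacent a c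

end Densities

section Algorithm

variable {p : ℕ} {ι : Type*}

/-- Strong protection of an arrow `a → b` of `G` w.r.t. the family of targets `T`. -/
def StronglyProtected (T : ι → Finset (Fin p)) (G : MixedGraph p) (a b : Fin p) : Prop :=
  (∃ j, (T j ∩ {a, b}).card = 1) ∨
  (∃ c, G.Arrow c a ∧ c ≠ b ∧ ¬ G.Adjacent c b) ∨
  (∃ c, G.Arrow c b ∧ c ≠ a ∧ ¬ G.Adjacent c a) ∨
  (∃ c, G.Arrow a c ∧ G.Arrow c b) ∨
  (∃ c₁ c₂, G.Line a c₁ ∧ G.Line a c₂ ∧ G.Arrow c₁ b ∧ G.Arrow c₂ b ∧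
    c₁ ≠ c₂ ∧ ¬ G.Adjacent c₁ c₂)

/-- Every arrow of `G` is strongly protected in `G`. -/
def AllArrowsProtected (T : ι → Finset (Fin p)) (G : MixedGraph p) : Prop :=
  ∀ a b, G.Arrow a b → StronglyProtected T G a b

/-- `ReplaceUnprotectedRun T n G H`: starting with the graph `G`, the loop
`while there is an arrow a → b of G which is not strongly protected in G do G ← G + (b, a)`
can reach the graph `H` by `n` passes, for some choice of the arrows. -/
inductive ReplaceUnprotectedRun (T : ι → Finset (Fin p)) :
    ℕ → MixedGraph p → MixedGraph p → Prop
  | start (G : MixedGraph p) : ReplaceUnprotectedRun T 0 G G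
  | pass {n : ℕ} {G H : MixedGraph p} {a b : Fin p} (hab : G.Arrow a b)
      (hnot : ¬ StronglyProtected T G a b)
      (hrun : ReplaceUnprotectedRun T n (G.addEdge b a hab.ne.symm) H) :
      ReplaceUnprotectedRun T (n + 1) G H

/-- Some execution of the loop on the input `G` leaves the loop, with the output `H`. -/
def ReplaceUnprotectedReturns (T : ι → Finset (Fin p)) (G H : MixedGraph p) : Prop :=
  (∃ n, ReplaceUnprotectedRun T n G H) ∧ AllArrowsProtected T H

end Algorithm

/-!
Two DAGs are interventionally Markov equivalent iff they have the same skeleton, the same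
v-structures and the same orientation of the edges that are separated by a target. Indeed,
graphically equivalent DAGs are joined by reversals of covered arrows, which preserve the densities;
conversely, product densities perturbed by the parity of a few binary variables detect adjacencies,
v-structures and the direction of separated edges.

The arrows of a DAG that are forced by these data are those compelled by the orientation rules. If a
compelled arrow points to a vertex of the graph formed by the other edges, it points to every vertex
of the same component. This graph is chordal, so it has a perfect elimination order that directs any
given edge as prescribed; hence none of its edges is forced. The orientation rules mirror strong
protection: compelled arrows are protected in every partial essential graph, and conversely a first
arrow that is not compelled is not protected.
-/

section Ranks

variable {α β : Type*}

/-- The number of proper ancestors of `a` with respect to the relation `R`; for an acyclic `R` it is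
a topological order. -/
noncomputable def ancestorCount (R : α → α → Prop) (a : α) : ℕ :=
  {z | Relation.TransGen R z a}.ncard

theorem ancestorCount_lt_of_rel [Finite α] {R : α → α → Prop} {a b : α}
    (ha : ¬ Relation.TransGen R a a) (hab : R a b) : ancestorCount R a < ancestorCount R b :=
  Set.ncard_lt_ncard (Set.ssubset_iff_exists.2 ⟨fun _ hz => hz.tail hab, a, .single hab, ha⟩)

theorem ancestorCount_congr {R : α → α → Prop} {a b : α} (h : ∀ z, R z a ↔ R z b) :
    ancestorCount R a = ancestorCount R b := by
  simp only [ancestorCount, Relation.TransGen.tail'_iff, h]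

theorem exists_rel_min_snd_max_fst [Finite α] [LinearOrder β] {P : α → α → Prop} (r : α → β)
    {a b : α} (hab : P a b) :
    ∃ a b, P a b ∧ (∀ x y, P x y → r b ≤ r y) ∧ ∀ x, P x b → r x ≤ r a := by
  obtain ⟨b', ⟨a', ha'⟩, hmin⟩ :=
    Set.exists_min_image {y | ∃ x, P x y} r (Set.toFinite _) ⟨b, a, hab⟩
  obtain ⟨a'', ha'', hmax⟩ := Set.exists_max_image {x | P x b'} r (Set.toFinite _) ⟨a', ha'⟩
  exact ⟨a'', b', ha'', fun x y hxy => hmin y ⟨x, hxy⟩, hmax⟩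

end Ranks

section PerfectOrders

variable {V β : Type*} [LinearOrder β] {U : SimpleGraph V} {v w b : V}

/-- The neighbours of `v` within `S` form a clique of the graph `U`. -/
def IsSimplicialIn (U : SimpleGraph V) (S : Set V) (v : V) : Prop :=
  U.IsClique (S ∩ U.neighborSet v)

theorem IsSimplicialIn.mono {S S' : Set V} (hv : IsSimplicialIn U S v)
    (h : ∀ x ∈ S', U.Adj v x → x ∈ S) : IsSimplicialIn U S' v :=
  fun x hx y hy => hv ⟨h x hx.1 hx.2, hx.2⟩ ⟨h y hy.1 hy.2, hy.2⟩

/-- The function `r` orders the vertices of `S` such that each of them is simplicial among its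
predecessors: a perfect elimination order of the subgraph induced on `S`, read backwards. Ties
between nonadjacent vertices are allowed. -/
structure IsPerfectOrderOn (U : SimpleGraph V) (r : V → β) (S : Set V) : Prop where
  ne_of_adj : ∀ ⦃x⦄, x ∈ S → ∀ ⦃y⦄, y ∈ S → U.Adj x y → r x ≠ r y
  isSimplicialIn : ∀ ⦃v⦄, v ∈ S → IsSimplicialIn U {x ∈ S | r x < r v} v

namespace IsPerfectOrderOn

variable {r : V → β} {S : Set V}

theorem mono {S' : Set V} (hr : IsPerfectOrderOn U r S) (h : S' ⊆ S) : IsPerfectOrderOn U r S' where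
  ne_of_adj _ hx _ hy := hr.ne_of_adj (h hx) (h hy)
  isSimplicialIn _ hv := (hr.isSimplicialIn (h hv)).mono fun _ hx _ => ⟨h hx.1, hx.2⟩

theorem isSimplicialIn_of_forall_le (hr : IsPerfectOrderOn U r S) (hv : v ∈ S)
    (hmax : ∀ x ∈ S, r x ≤ r v) : IsSimplicialIn U S v :=
  (hr.isSimplicialIn hv).mono fun x hx hvx =>
    ⟨hx, (hmax x hx).lt_of_ne (hr.ne_of_adj hv hx hvx).symm⟩

/-- Dirac's theorem on simplicial vertices. -/
theorem exists_isSimplicialIn_notMem {S : Finset V} (hr : IsPerfectOrderOn U r S) {K : Set V}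
    (hK : U.IsClique K) (hKS : K ⊂ S) : ∃ w ∈ S, w ∉ K ∧ IsSimplicialIn U S w := by
  classical
  induction S using Finset.strongInduction generalizing K with
  | H S ih =>
    obtain ⟨u, huS, huK⟩ := Set.exists_of_ssubset hKS
    obtain ⟨v, hv, hmax⟩ := S.exists_max_image r ⟨u, huS⟩
    have hvs : IsSimplicialIn U S v := hr.isSimplicialIn_of_forall_le hv hmax
    by_cases hvK : v ∈ K
    swap
    · exact ⟨v, hv, hvK, hvs⟩
    have hsub : ↑S ∩ U.neighborSet v ⊆ (S.erase v : Finset V) := fun x hx =>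
      Finset.mem_erase.2 ⟨(U.ne_of_adj hx.2).symm, hx.1⟩
    rcases hsub.eq_or_ssubset with heq | hss
    · have hS : U.IsClique (S : Set V) := by
        rw [← Finset.insert_erase hv, Finset.coe_insert, ← heq]
        exact hvs.insert fun x hx _ => hx.2
      exact ⟨u, huS, huK, hS.subset Set.inter_subset_left⟩
    · obtain ⟨w, hw, hwv, hws⟩ :=
        ih _ (Finset.erase_ssubset hv) (hr.mono (Finset.coe_subset.2 (S.erase_subset v))) hvs hss
      obtain ⟨hne, hwS⟩ := Finset.mem_erase.1 hw
      have hadj : ¬ U.Adj v w := fun h => hwv ⟨hwS, h⟩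
      refine ⟨w, hwS, fun hwK => hadj (hK hvK hwK hne.symm), hws.mono fun x hx hwx => ?_⟩
      exact Finset.mem_erase.2 ⟨by rintro rfl; exact hadj hwx.symm, hx⟩

theorem update_insert [DecidableEq V] (hr : IsPerfectOrderOn U r S) (hw : w ∉ S)
    (hws : IsSimplicialIn U S w) {m : β} (hm : ∀ x ∈ S, r x < m) :
    IsPerfectOrderOn U (Function.update r w m) (insert w S) := by
  have hself : Function.update r w m w = m := Function.update_self ..
  have hS : ∀ {x}, x ∈ S → Function.update r w m x = r x := fun hx =>
    Function.update_of_ne (by rintro rfl; exact hw hx) ..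
  refine ⟨?_, ?_⟩
  · rintro x (rfl | hx) y (rfl | hy) hxy
    · exact absurd hxy (U.irrefl)
    · rw [hself, hS hy]; exact (hm y hy).ne'
    · rw [hself, hS hx]; exact (hm x hx).ne
    · rw [hS hx, hS hy]; exact hr.ne_of_adj hx hy hxy
  · rintro v (rfl | hv)
    · refine hws.mono ?_
      rintro x ⟨rfl | hx, -⟩ hvx
      exacts [absurd hvx U.irrefl, hx]
    · refine (hr.isSimplicialIn hv).mono ?_
      rintro x ⟨rfl | hx, hlt⟩ -
      · rw [hself, hS hv] at hlt
        exact absurd hlt (hm v hv).asymm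
      · rw [hS hx, hS hv] at hlt
        exact ⟨hx, hlt⟩

theorem exists_isPerfectOrderOn_lt {S : Finset V} (hr : IsPerfectOrderOn U r S) (hb : b ∈ S) :
    ∃ s : V → ℕ, IsPerfectOrderOn U s S ∧ ∀ x ∈ S, x ≠ b → s b < s x := by
  classical
  induction S using Finset.strongInduction with
  | H S ih =>
    rcases (Set.singleton_subset_iff.2 (Finset.mem_coe.2 hb)).eq_or_ssubset with heq | hss
    · refine ⟨0, ?_, fun x hx hxb => absurd ?_ hxb⟩
      · rw [← heq]
        exact ⟨by rintro x rfl y rfl h; exact absurd h U.irrefl,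
          fun _ _ x hx => absurd hx.1.2 (lt_irrefl 0)⟩
      · exact heq.symm.subset hx
    obtain ⟨w, hw, hwb, hws⟩ :=
      hr.exists_isSimplicialIn_notMem (SimpleGraph.isClique_singleton (G := U) b) hss
    have hsub : ((S.erase w : Finset V) : Set V) ⊆ S := Finset.coe_subset.2 (S.erase_subset w)
    have hbw : b ∈ S.erase w := Finset.mem_erase.2 ⟨fun h => hwb h.symm, hb⟩
    obtain ⟨s, hs, hsb⟩ := ih (S.erase w) (Finset.erase_ssubset hw) (hr.mono hsub) hbw
    have hm : ∀ x ∈ S.erase w, s x < (S.erase w).sup s + 1 := fun x hx =>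
      Nat.lt_succ_of_le (Finset.le_sup hx)
    have hupdate := hs.update_insert (w := w) (by simp)
      (hws.mono fun x hx _ => hsub hx) hm
    rw [← Finset.coe_insert, Finset.insert_erase hw] at hupdate
    refine ⟨_, hupdate, fun x hx hxb => ?_⟩
    rw [Function.update_of_ne (Finset.ne_of_mem_erase hbw)]
    rcases eq_or_ne x w with rfl | hxw
    · rw [Function.update_self]
      exact hm b hbw
    · rw [Function.update_of_ne hxw]
      exact hsb x (Finset.mem_erase.2 ⟨hxw, hx⟩) hxb

end IsPerfectOrderOn

end PerfectOrders

namespace MixedGraph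

variable {p : ℕ} {G D D' : MixedGraph p} {a b c : Fin p}

theorem Adjacent.symm (h : G.Adjacent a b) : G.Adjacent b a := Or.symm h

theorem Adjacent.ne (h : G.Adjacent a b) : a ≠ b :=
  h.elim (G.ne_of_edge a b) fun h => (G.ne_of_edge b a h).symm

namespace IsDAG

theorem of_rank {α : Type*} [Preorder α] (r : Fin p → α) (hr : ∀ a b, D.Edge a b → r a < r b) :
    D.IsDAG := by
  refine ⟨fun a b hab => ⟨hab, fun hba => (hr a b hab).asymm (hr b a hba)⟩, fun a ha => ?_⟩
  have hlt : Relation.TransGen (· < ·) (r a) (r a) := ha.lift r hr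
  exact lt_irrefl _ (Relation.transGen_eq_self (r := ((· < ·) : α → α → Prop)) ▸ hlt)

theorem exists_rank (hD : D.IsDAG) : ∃ r : Fin p → ℕ, ∀ a b, D.Edge a b → r a < r b :=
  ⟨ancestorCount D.Edge, fun a _ => ancestorCount_lt_of_rel (hD.2 a)⟩

theorem asymm (hD : D.IsDAG) (h : D.Edge a b) : ¬ D.Edge b a := (hD.1 a b h).2

theorem arrow_iff (hD : D.IsDAG) : D.Arrow a b ↔ D.Edge a b := ⟨And.left, hD.1 a b⟩

theorem mem_parents (hD : D.IsDAG) : b ∈ D.parents a ↔ D.Edge b a := by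
  simp [parents, hD.arrow_iff]

theorem edge_trans (hD : D.IsDAG) (hab : D.Edge a b) (hbc : D.Edge b c)
    (hac : D.Adjacent a c) : D.Edge a c :=
  hac.resolve_right fun hca => hD.2 a (.tail (.tail (.single hab) hbc) hca)

theorem intervene (hD : D.IsDAG) (I : Finset (Fin p)) : (D.intervene I).IsDAG := by
  obtain ⟨r, hr⟩ := hD.exists_rank
  exact .of_rank r fun a b hab => hr a b hab.1

end IsDAG

/-- `a → b ← c` is an induced subgraph of the DAG `D`. -/
structure VStructure (D : MixedGraph p) (a b c : Fin p) : Prop where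
  left : D.Edge a b
  right : D.Edge c b
  ne : a ≠ c
  not_adjacent : ¬ D.Adjacent a c

theorem VStructure.symm (h : D.VStructure a b c) : D.VStructure c b a :=
  ⟨h.right, h.left, h.ne.symm, fun h' => h.not_adjacent h'.symm⟩

end MixedGraph

/-- Some target contains exactly one of the vertices `a` and `b`. -/
def Separated {p : ℕ} {ι : Type*} (T : ι → Finset (Fin p)) (a b : Fin p) : Prop :=
  ∃ j, ¬ (a ∈ T j ↔ b ∈ T j)

theorem Separated.symm {p : ℕ} {ι : Type*} {T : ι → Finset (Fin p)} {a b : Fin p}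
    (h : Separated T a b) : Separated T b a :=
  h.imp fun _ hj hba => hj hba.symm

namespace MixedGraph

variable {p : ℕ} {ι : Type*} {T : ι → Finset (Fin p)} {D D' D₁ D₂ D₃ : MixedGraph p}
  {a b c d : Fin p}

/-- The graphical counterpart of interventional Markov equivalence: equal skeletons, equal
v-structures, and equal orientation of the edges that are separated by a target. -/
structure GraphicallyEquivalent (T : ι → Finset (Fin p)) (D₁ D₂ : MixedGraph p) : Prop where
  adjacent_iff : ∀ a b, D₁.Adjacent a b ↔ D₂.Adjacent a b
  vStructure_iff : ∀ a b c, D₁.VStructure a b c ↔ D₂.VStructure a b c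
  edge_iff_of_separated : ∀ a b, Separated T a b → (D₁.Edge a b ↔ D₂.Edge a b)

namespace GraphicallyEquivalent

theorem refl (T : ι → Finset (Fin p)) (D : MixedGraph p) : GraphicallyEquivalent T D D :=
  ⟨fun _ _ => .rfl, fun _ _ _ => .rfl, fun _ _ _ => .rfl⟩

theorem symm (h : GraphicallyEquivalent T D₁ D₂) : GraphicallyEquivalent T D₂ D₁ :=
  ⟨fun a b => (h.adjacent_iff a b).symm, fun a b c => (h.vStructure_iff a b c).symm,
    fun a b hab => (h.edge_iff_of_separated a b hab).symm⟩

theorem trans (h : GraphicallyEquivalent T D₁ D₂) (h' : GraphicallyEquivalent T D₂ D₃) :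
    GraphicallyEquivalent T D₁ D₃ :=
  ⟨fun a b => (h.adjacent_iff a b).trans (h'.adjacent_iff a b),
    fun a b c => (h.vStructure_iff a b c).trans (h'.vStructure_iff a b c),
    fun a b hab => (h.edge_iff_of_separated a b hab).trans (h'.edge_iff_of_separated a b hab)⟩

theorem edge_of_not_edge (h : GraphicallyEquivalent T D₁ D₂) (hab : D₁.Edge a b)
    (hba : ¬ D₂.Edge b a) : D₂.Edge a b :=
  ((h.adjacent_iff a b).1 (Or.inl hab)).resolve_right hba

end GraphicallyEquivalent

/-- The arrows of the DAG `D` whose direction follows from the v-structures and the targets by the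
orientation rules, which forbid new v-structures and directed cycles. -/
inductive Compelled (T : ι → Finset (Fin p)) (D : MixedGraph p) : Fin p → Fin p → Prop
  | separated {a b : Fin p} (hab : D.Edge a b) (hs : Separated T a b) : Compelled T D a b
  | collider {a b c : Fin p} (h : D.VStructure a b c) : Compelled T D a b
  | away {a b c : Fin p} (hca : Compelled T D c a) (hab : D.Edge a b) (hcb : ¬ D.Adjacent c b) :
      Compelled T D a b
  | path {a b c : Fin p} (hac : Compelled T D a c) (hcb : Compelled T D c b)
      (hab : D.Edge a b) : Compelled T D a b
  | diamond {a b c₁ c₂ : Fin p} (h : D.VStructure c₁ b c₂) (hab : D.Edge a b)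
      (h₁ : D.Adjacent a c₁) (h₂ : D.Adjacent a c₂) (ha : ¬ D.VStructure c₁ a c₂) :
      Compelled T D a b

theorem Compelled.edge (h : Compelled T D a b) : D.Edge a b := by
  cases h with
  | separated hab => exact hab
  | collider h => exact h.left
  | away _ hab _ => exact hab
  | path _ _ hab => exact hab
  | diamond _ hab => exact hab

theorem Compelled.edge_of_graphicallyEquivalent (hD : D.IsDAG) (hD' : D'.IsDAG)
    (he : GraphicallyEquivalent T D D') (h : Compelled T D a b) : D'.Edge a b := by
  induction h with
  | separated hab hs => exact (he.edge_iff_of_separated _ _ hs).1 hab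
  | collider h => exact ((he.vStructure_iff _ _ _).1 h).left
  | @away a b c hca hab hcb ih =>
    refine he.edge_of_not_edge hab fun hba => hD.asymm hab ?_
    have hne : c ≠ b := by rintro rfl; exact hD.asymm hab hca.edge
    exact ((he.vStructure_iff c a b).2 ⟨ih, hba, hne, mt (he.adjacent_iff c b).2 hcb⟩).right
  | path _ _ hab ih₁ ih₂ => exact hD'.edge_trans ih₁ ih₂ ((he.adjacent_iff _ _).1 (Or.inl hab))
  | @diamond a b c₁ c₂ h hab h₁ h₂ ha =>
    refine he.edge_of_not_edge hab fun hba => ha ?_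
    have h' := (he.vStructure_iff _ _ _).1 h
    exact (he.vStructure_iff _ _ _).2
      ⟨hD'.edge_trans h'.left hba ((he.adjacent_iff _ _).1 h₁.symm),
        hD'.edge_trans h'.right hba ((he.adjacent_iff _ _).1 h₂.symm), h'.ne, h'.not_adjacent⟩

/-- The undirected graph of the edges of `D` that are not compelled. -/
def freeGraph (T : ι → Finset (Fin p)) (D : MixedGraph p) : SimpleGraph (Fin p) where
  Adj a b := D.Adjacent a b ∧ ¬ Compelled T D a b ∧ ¬ Compelled T D b a
  symm := ⟨fun _ _ h => ⟨h.1.symm, h.2.2, h.2.1⟩⟩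
  loopless := ⟨fun _ h => h.1.ne rfl⟩

theorem not_separated_of_free (h : (freeGraph T D).Adj a b) : ¬ Separated T a b := fun hs =>
  h.1.elim (fun hab => h.2.1 (.separated hab hs)) fun hba => h.2.2 (.separated hba hs.symm)

theorem adjacent_of_compelled_of_free (h : Compelled T D a b) (hbc : (freeGraph T D).Adj b c) :
    D.Adjacent a c := by
  by_contra hac
  rcases hbc.1 with hbc' | hcb
  · exact hbc.2.1 (h.away hbc' hac)
  · have hne : c ≠ a := by rintro rfl; exact hbc.2.2 h
    exact hbc.2.2 (.collider ⟨hcb, h.edge, hne, fun hca => hac hca.symm⟩)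

theorem compelled_or_free_of_free (hD : D.IsDAG) (h : Compelled T D a b)
    (hbc : (freeGraph T D).Adj b c) : Compelled T D a c ∨ (freeGraph T D).Adj a c := by
  rw [or_iff_not_imp_left]
  exact fun hac => ⟨adjacent_of_compelled_of_free h hbc, hac, fun hca =>
    hbc.2.2 (hca.path h (hD.edge_trans hca.edge h.edge hbc.1.symm))⟩

theorem VStructure.of_free (hD : D.IsDAG) (h : D.VStructure a b d)
    (hbc : (freeGraph T D).Adj b c) : D.VStructure a c d := by
  have hac := adjacent_of_compelled_of_free (.collider h) hbc
  have hdc := adjacent_of_compelled_of_free (.collider h.symm) hbc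
  rcases hbc.1 with hbc' | hcb
  · exact ⟨hD.edge_trans h.left hbc' hac, hD.edge_trans h.right hbc' hdc, h.ne, h.not_adjacent⟩
  · by_contra hn
    exact hbc.2.2 (.diamond h hcb hac.symm hdc.symm hn)

theorem Compelled.of_free (hD : D.IsDAG) (h : Compelled T D a b)
    (hbc : (freeGraph T D).Adj b c) : Compelled T D a c := by
  induction h generalizing c with
  | separated hab hs =>
    refine (compelled_or_free_of_free hD (.separated hab hs) hbc).resolve_right fun hac => ?_
    obtain ⟨j, hj⟩ := hs
    have hj_free : ∀ {x y}, (freeGraph T D).Adj x y → (x ∈ T j ↔ y ∈ T j) := fun hxy =>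
      not_not.1 fun hn => not_separated_of_free hxy ⟨j, hn⟩
    exact hj ((hj_free hac).trans (hj_free hbc).symm)
  | collider h => exact .collider (h.of_free hD hbc)
  | away hda hab hdb ih =>
    refine (compelled_or_free_of_free hD (hda.away hab hdb) hbc).resolve_right fun hac => hdb ?_
    exact adjacent_of_compelled_of_free (ih hac) hbc.symm
  | path had hdb hab _ ih =>
    have hdc := ih hbc
    refine had.path hdc (hD.edge_trans had.edge hdc.edge ?_)
    exact adjacent_of_compelled_of_free (had.path hdb hab) hbc
  | diamond h hab h₁ h₂ ha =>
    refine (compelled_or_free_of_free hD (.diamond h hab h₁ h₂ ha) hbc).resolve_right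
      fun hac => ha ?_
    exact (h.of_free hD hbc).of_free hD hac.symm

/-- The graph obtained from `D` by keeping the compelled arrows and orienting the other edges along
the function `s`. -/
def reorient {β : Type*} [LT β] (T : ι → Finset (Fin p)) (D : MixedGraph p) (s : Fin p → β) :
    MixedGraph p where
  Edge a b := Compelled T D a b ∨ (freeGraph T D).Adj a b ∧ s a < s b
  ne_of_edge a b h := h.elim (fun h => D.ne_of_edge a b h.edge) fun h => h.1.ne

/-- The arrows that `s` orients are free, so their ends have the same compelled ancestors. -/
theorem isDAG_reorient {β : Type*} [Preorder β] (hD : D.IsDAG) (s : Fin p → β) :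
    (reorient T D s).IsDAG := by
  refine .of_rank (fun a => toLex (ancestorCount (Compelled T D) a, s a)) ?_
  rintro a b (hab | ⟨hab, hs⟩)
  · refine Prod.Lex.toLex_lt_toLex.2 (Or.inl (ancestorCount_lt_of_rel (fun ha => ?_) hab))
    exact hD.2 a (Relation.TransGen.mono (fun _ _ h => h.edge) _ _ ha)
  · refine Prod.Lex.toLex_lt_toLex.2 (Or.inr ⟨ancestorCount_congr fun z => ?_, hs⟩)
    exact ⟨fun h => h.of_free hD hab, fun h => h.of_free hD hab.symm⟩

theorem adjacent_reorient_iff {β : Type*} [LinearOrder β] {s : Fin p → β}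
    (hs : IsPerfectOrderOn (freeGraph T D) s Set.univ) :
    (reorient T D s).Adjacent a b ↔ D.Adjacent a b := by
  constructor
  · rintro ((h | h) | (h | h))
    exacts [Or.inl h.edge, h.1.1, Or.inr h.edge, h.1.1.symm]
  · intro h
    by_cases hab : Compelled T D a b
    · exact Or.inl (Or.inl hab)
    by_cases hba : Compelled T D b a
    · exact Or.inr (Or.inl hba)
    have hfree : (freeGraph T D).Adj a b := ⟨h, hab, hba⟩
    rcases (hs.ne_of_adj trivial trivial hfree).lt_or_gt with hlt | hlt
    exacts [Or.inl (Or.inr ⟨hfree, hlt⟩), Or.inr (Or.inr ⟨hfree.symm, hlt⟩)]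

theorem vStructure_reorient_iff {β : Type*} [LinearOrder β] {s : Fin p → β}
    (hs : IsPerfectOrderOn (freeGraph T D) s Set.univ) :
    (reorient T D s).VStructure a b c ↔ D.VStructure a b c := by
  constructor
  · rintro ⟨hab, hcb, hac, hn⟩
    rw [adjacent_reorient_iff hs] at hn
    rcases hab with hab | hab <;> rcases hcb with hcb | hcb
    · exact ⟨hab.edge, hcb.edge, hac, hn⟩
    · exact absurd (adjacent_of_compelled_of_free hab hcb.1.symm) hn
    · exact absurd (adjacent_of_compelled_of_free hcb hab.1.symm).symm hn
    · have hclique := hs.isSimplicialIn (Set.mem_univ b)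
      exact absurd (hclique ⟨⟨trivial, hab.2⟩, hab.1.symm⟩ ⟨⟨trivial, hcb.2⟩, hcb.1.symm⟩ hac).1 hn
  · exact fun h => ⟨Or.inl (.collider h), Or.inl (.collider h.symm), h.ne,
      mt (adjacent_reorient_iff hs).1 h.not_adjacent⟩

theorem graphicallyEquivalent_reorient {β : Type*} [LinearOrder β] {s : Fin p → β}
    (hs : IsPerfectOrderOn (freeGraph T D) s Set.univ) :
    GraphicallyEquivalent T (reorient T D s) D where
  adjacent_iff _ _ := adjacent_reorient_iff hs
  vStructure_iff _ _ _ := vStructure_reorient_iff hs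
  edge_iff_of_separated _ _ hab :=
    ⟨fun h => h.elim Compelled.edge fun h => absurd hab (not_separated_of_free h.1),
      fun h => Or.inl (.separated h hab)⟩

theorem IsDAG.isPerfectOrderOn_freeGraph {β : Type*} [LinearOrder β] (hD : D.IsDAG)
    {r : Fin p → β} (hr : ∀ a b, D.Edge a b → r a < r b) :
    IsPerfectOrderOn (freeGraph T D) r Set.univ where
  ne_of_adj a _ b _ hab := hab.1.elim (fun h => (hr a b h).ne) fun h => (hr b a h).ne'
  isSimplicialIn := by
    have hedge : ∀ {x y}, D.Adjacent x y → r x < r y → D.Edge x y := fun h hxy =>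
      h.resolve_right fun h' => (hr _ _ h').asymm hxy
    rintro b - x ⟨⟨-, hx⟩, hbx⟩ z ⟨⟨-, hz⟩, hbz⟩ hxz
    refine ⟨?_, fun hc => hbx.2.2 (hc.of_free hD hbz.symm), fun hc =>
      hbz.2.2 (hc.of_free hD hbx.symm)⟩
    by_contra hn
    exact hbx.2.2 (.collider ⟨hedge hbx.1.symm hx, hedge hbz.1.symm hz, hxz, hn⟩)

theorem exists_graphicallyEquivalent_edge_of_free (hD : D.IsDAG) (hba : (freeGraph T D).Adj b a) :
    ∃ D' : MixedGraph p, D'.IsDAG ∧ GraphicallyEquivalent T D' D ∧ D'.Edge b a := by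
  obtain ⟨r, hr⟩ := hD.exists_rank
  have hperfect : IsPerfectOrderOn (freeGraph T D) r (Finset.univ : Finset (Fin p)) := by
    simpa using hD.isPerfectOrderOn_freeGraph hr
  obtain ⟨s, hs, hb⟩ := hperfect.exists_isPerfectOrderOn_lt (Finset.mem_univ b)
  rw [Finset.coe_univ] at hs
  exact ⟨reorient T D s, isDAG_reorient hD s, graphicallyEquivalent_reorient hs,
    Or.inr ⟨hba, hb a (Finset.mem_univ a) hba.ne.symm⟩⟩

/-- The union of all DAGs that are graphically equivalent to `D`, described by the orientation
rules: a compelled arrow stays an arrow, the other edges of `D` become lines. -/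
def completedPattern (T : ι → Finset (Fin p)) (D : MixedGraph p) : MixedGraph p where
  Edge a b := D.Adjacent a b ∧ ¬ Compelled T D b a
  ne_of_edge _ _ h := h.1.ne

theorem completedPattern_edge_iff (hD : D.IsDAG) :
    (completedPattern T D).Edge a b ↔
      ∃ D' : MixedGraph p, D'.IsDAG ∧ GraphicallyEquivalent T D' D ∧ D'.Edge a b := by
  constructor
  · rintro ⟨hadj, hba⟩
    by_cases hab : Compelled T D a b
    · exact ⟨D, hD, .refl T D, hab.edge⟩
    · exact exists_graphicallyEquivalent_edge_of_free hD ⟨hadj, hab, hba⟩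
  · rintro ⟨D', hD', he, hab⟩
    refine ⟨(he.adjacent_iff a b).1 (Or.inl hab), fun hba => hD'.asymm hab ?_⟩
    exact hba.edge_of_graphicallyEquivalent hD hD' he.symm

theorem le_completedPattern (hD : D.IsDAG) : D ≤ completedPattern T D := fun _ _ hab =>
  (completedPattern_edge_iff hD).2 ⟨D, hD, .refl T D, hab⟩

theorem arrow_completedPattern_iff (hD : D.IsDAG) :
    (completedPattern T D).Arrow a b ↔ Compelled T D a b :=
  ⟨fun h => not_not.1 fun hab => h.2 ⟨h.1.1.symm, hab⟩,
    fun h => ⟨le_completedPattern hD a b h.edge, fun hba => hba.2 h⟩⟩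

theorem line_completedPattern_iff :
    (completedPattern T D).Line a b ↔ (freeGraph T D).Adj a b :=
  ⟨fun h => ⟨h.1.1, h.2.2, h.1.2⟩, fun h => ⟨⟨h.1, h.2.2⟩, h.1.symm, h.2.1⟩⟩

/-- The graph `D` with its edge between `a` and `b` reversed, in whichever direction it points. -/
def reverse (D : MixedGraph p) (a b : Fin p) : MixedGraph p where
  Edge x y := if s(x, y) = s(a, b) then D.Edge y x else D.Edge x y
  ne_of_edge x y h := by
    split_ifs at h
    exacts [(D.ne_of_edge y x h).symm, D.ne_of_edge x y h]

theorem reverse_edge_self : (D.reverse a b).Edge a b ↔ D.Edge b a := by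
  simp [reverse]

theorem reverse_edge_swap : (D.reverse a b).Edge b a ↔ D.Edge a b := by
  simp [reverse]

theorem reverse_edge_of_ne {x y : Fin p} (h : s(x, y) ≠ s(a, b)) :
    (D.reverse a b).Edge x y ↔ D.Edge x y := by
  simp only [reverse, if_neg h]

theorem reverse_reverse (D : MixedGraph p) (a b : Fin p) : (D.reverse a b).reverse a b = D := by
  ext x y
  by_cases h : s(x, y) = s(a, b)
  · simp only [reverse, if_pos h, if_pos (Sym2.eq_swap.trans h)]
  · simp only [reverse, if_neg h]

theorem reverse_comm (D : MixedGraph p) (a b : Fin p) : D.reverse a b = D.reverse b a := by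
  simp only [reverse, Sym2.eq_swap (a := a)]

theorem adjacent_reverse_iff {x y : Fin p} : (D.reverse a b).Adjacent x y ↔ D.Adjacent x y := by
  by_cases h : s(x, y) = s(a, b)
  · simp only [Adjacent, reverse, if_pos h, if_pos (Sym2.eq_swap.trans h), or_comm]
  · simp only [Adjacent, reverse, if_neg h, if_neg fun h' => h (Sym2.eq_swap.trans h')]

theorem reverse_eq_self_of_not_adjacent (h : ¬ D.Adjacent a b) : D.reverse a b = D := by
  ext x y
  by_cases hxy : s(x, y) = s(a, b)
  · have hn : ¬ D.Adjacent x y := by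
      rcases Sym2.eq_iff.1 hxy with ⟨rfl, rfl⟩ | ⟨rfl, rfl⟩
      exacts [h, fun h' => h h'.symm]
    simp only [Adjacent, not_or] at hn
    simp only [reverse, if_pos hxy, hn.1, hn.2]
  · exact reverse_edge_of_ne hxy

theorem reverse_intervene {I : Finset (Fin p)} (hI : a ∈ I ↔ b ∈ I) :
    (D.reverse a b).intervene I = (D.intervene I).reverse a b := by
  ext x y
  by_cases h : s(x, y) = s(a, b)
  · have hxy : x ∈ I ↔ y ∈ I := by
      rcases Sym2.eq_iff.1 h with ⟨rfl, rfl⟩ | ⟨rfl, rfl⟩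
      exacts [hI, hI.symm]
    simp only [intervene, reverse, if_pos h, hxy]
  · simp only [intervene, reverse, if_neg h]

/-- `a → b` is a covered arrow: the other parents of `b` are the parents of `a`. -/
structure Covered (D : MixedGraph p) (a b : Fin p) : Prop where
  edge : D.Edge a b
  edge_iff : ∀ c ≠ a, (D.Edge c b ↔ D.Edge c a)

namespace Covered

theorem not_edge_swap (h : D.Covered a b) : ¬ D.Edge b a := fun hba =>
  D.ne_of_edge b b ((h.edge_iff b (D.ne_of_edge b a hba)).2 hba) rfl

theorem reverse (h : D.Covered a b) : (D.reverse a b).Covered b a where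
  edge := reverse_edge_swap.2 h.edge
  edge_iff c hcb := by
    rcases eq_or_ne c a with rfl | hca
    · rw [reverse_edge_self]
      exact iff_of_false (fun hcc => MixedGraph.ne_of_edge _ c c hcc rfl) h.not_edge_swap
    · rw [reverse_edge_of_ne (by simp [hca, hcb]), reverse_edge_of_ne (by simp [hca, hcb]),
        h.edge_iff c hca]

/-- A topological order of `D` becomes one of the reversed graph when `b` is moved right before
`a`: the parents of `b` precede `a` because the arrow is covered. -/
theorem isDAG_reverse (h : D.Covered a b) (hD : D.IsDAG) : (D.reverse a b).IsDAG := by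
  obtain ⟨r, hr⟩ := hD.exists_rank
  have hab := hr a b h.edge
  refine .of_rank (fun x => if x = a then 2 * r a + 1 else if x = b then 2 * r a else 2 * r x)
    fun x y hxy => ?_
  by_cases hs : s(x, y) = s(a, b)
  · rcases Sym2.eq_iff.1 hs with ⟨rfl, rfl⟩ | ⟨rfl, rfl⟩
    · exact absurd (reverse_edge_self.1 hxy) h.not_edge_swap
    · simp [D.ne_of_edge _ _ (reverse_edge_swap.1 hxy) |>.symm]
  · have hxy' := (reverse_edge_of_ne hs).1 hxy
    have hlt := hr x y hxy'
    have hpar : y = b → x ≠ a → r x < r a := by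
      rintro rfl hxa
      exact hr x a ((h.edge_iff x hxa).1 hxy')
    grind

theorem vStructure_reverse (h : D.Covered a b) {x y z : Fin p} (hv : D.VStructure x y z) :
    (D.reverse a b).VStructure x y z := by
  have hne : ∀ {x z}, D.VStructure x y z → s(x, y) ≠ s(a, b) := by
    intro x z hv hs
    rcases Sym2.eq_iff.1 hs with ⟨rfl, rfl⟩ | ⟨rfl, rfl⟩
    · exact hv.not_adjacent (Or.inr ((h.edge_iff z hv.ne.symm).1 hv.right))
    · exact h.not_edge_swap hv.left
  exact ⟨(reverse_edge_of_ne (hne hv)).2 hv.left, (reverse_edge_of_ne (hne hv.symm)).2 hv.right,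
    hv.ne, mt adjacent_reverse_iff.1 hv.not_adjacent⟩

theorem graphicallyEquivalent_reverse (h : D.Covered a b) (hs : ¬ Separated T a b) :
    GraphicallyEquivalent T (D.reverse a b) D where
  adjacent_iff _ _ := adjacent_reverse_iff
  vStructure_iff x y z := by
    refine ⟨fun hv => ?_, h.vStructure_reverse⟩
    rw [← reverse_reverse D a b, reverse_comm]
    exact h.reverse.vStructure_reverse hv
  edge_iff_of_separated x y hxy := by
    refine reverse_edge_of_ne fun hne => hs ?_
    rcases Sym2.eq_iff.1 hne with ⟨rfl, rfl⟩ | ⟨rfl, rfl⟩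
    exacts [hxy, hxy.symm]

end Covered

/-- The DAG `D'` arises from `D` by reversing a covered arrow that no target separates. -/
def CoveredReversal (T : ι → Finset (Fin p)) (D D' : MixedGraph p) : Prop :=
  ∃ a b, D.Covered a b ∧ ¬ Separated T a b ∧ D' = D.reverse a b

namespace GraphicallyEquivalent

theorem exists_covered_edge_swap (h : GraphicallyEquivalent T D₁ D₂) (h₁ : D₁.IsDAG)
    (h₂ : D₂.IsDAG) (hab : D₁.Edge a b) (hba : D₂.Edge b a) :
    ∃ a b, D₁.Covered a b ∧ ¬ Separated T a b ∧ D₂.Edge b a := by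
  obtain ⟨r, hr⟩ := h₁.exists_rank
  obtain ⟨a, b, ⟨hab, hba⟩, hmin, hmax⟩ := exists_rel_min_snd_max_fst
    (P := fun x y => D₁.Edge x y ∧ D₂.Edge y x) r ⟨hab, hba⟩
  have hagree : ∀ {x y}, r y < r b → D₁.Edge x y → D₂.Edge x y := fun hy hxy =>
    h.edge_of_not_edge hxy fun hyx => (hmin _ _ ⟨hxy, hyx⟩).not_gt hy
  refine ⟨a, b, ⟨hab, fun c hca => ⟨fun hcb => ?_, fun hca' => ?_⟩⟩, fun hs => ?_, hba⟩
  · have hadj : D₁.Adjacent c a := by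
      by_contra hn
      exact h₂.asymm hba ((h.vStructure_iff c b a).1 ⟨hcb, hab, hca, hn⟩).right
    refine hadj.resolve_right fun hac => ?_
    have hcb' : D₂.Edge c b := h.edge_of_not_edge hcb fun hbc =>
      (hmax c ⟨hcb, hbc⟩).not_gt (hr _ _ hac)
    exact h₂.asymm (h₂.edge_trans hcb' hba ((h.adjacent_iff _ _).1 hadj)) (hagree (hr _ _ hcb) hac)
  · refine h₁.edge_trans hca' hab (by_contra fun hn => ?_)
    have hcb : c ≠ b := by rintro rfl; exact h₁.asymm hab hca'
    have hv : D₂.VStructure c a b :=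
      ⟨hagree (hr _ _ hab) hca', hba, hcb, mt (h.adjacent_iff c b).2 hn⟩
    exact h₁.asymm hab ((h.vStructure_iff c a b).2 hv).right
  · exact h₂.asymm hba ((h.edge_iff_of_separated a b hs).1 hab)

/-- Chickering's theorem on covered arrow reversals, for interventional targets. -/
theorem reflTransGen_coveredReversal (h : GraphicallyEquivalent T D₁ D₂) (h₁ : D₁.IsDAG)
    (h₂ : D₂.IsDAG) : Relation.ReflTransGen (CoveredReversal T) D₁ D₂ := by
  induction hS : {e : Fin p × Fin p | D₁.Edge e.1 e.2 ∧ D₂.Edge e.2 e.1}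
    using WellFoundedLT.induction generalizing D₁ with
  | ind S ih =>
    by_cases hex : ∃ a b, D₁.Edge a b ∧ D₂.Edge b a
    · obtain ⟨a, b, hab, hba⟩ := hex
      obtain ⟨a, b, hc, hs, hba⟩ := h.exists_covered_edge_swap h₁ h₂ hab hba
      refine .head ⟨a, b, hc, hs, rfl⟩
        (ih _ ?_ ((hc.graphicallyEquivalent_reverse hs).trans h) (hc.isDAG_reverse h₁) rfl)
      subst hS
      refine Set.ssubset_iff_exists.2 ⟨?_, (a, b), ⟨hc.edge, hba⟩, fun hab => ?_⟩
      · rintro ⟨x, y⟩ ⟨hxy, hyx⟩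
        refine ⟨(reverse_edge_of_ne fun hne => ?_).1 hxy, hyx⟩
        rcases Sym2.eq_iff.1 hne with ⟨rfl, rfl⟩ | ⟨rfl, rfl⟩
        exacts [hc.not_edge_swap (reverse_edge_self.1 hxy), h₂.asymm hba hyx]
      · exact hc.not_edge_swap (reverse_edge_self.1 hab.1)
    · push Not at hex
      have heq : D₁ = D₂ := by
        ext x y
        exact ⟨fun hxy => h.edge_of_not_edge hxy (hex x y hxy),
          fun hxy => h.symm.edge_of_not_edge hxy fun hyx => hex y x hyx hxy⟩
      exact heq ▸ .refl

end GraphicallyEquivalent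

end MixedGraph

section Marginals

variable {δ : Type*} [DecidableEq δ] {X : δ → Type*} [∀ i, MeasurableSpace (X i)]
  {μ : ∀ i, Measure (X i)} {f g : (∀ i, X i) → ℝ≥0∞}

theorem lmarginal_mul_const (hf : Measurable f) {s : Finset δ}
    (hg : ∀ x y, g (Function.updateFinset x s y) = g x) (x : ∀ i, X i) :
    lmarginal μ s (fun x => f x * g x) x = lmarginal μ s f x * g x := by
  simp only [lmarginal, hg]
  exact lintegral_mul_const _ (hf.comp measurable_updateFinset)

variable [∀ i, SigmaFinite (μ i)]

theorem lmarginal_pos (hμ : ∀ i, μ i ≠ 0) (hf : Measurable f) (hpos : ∀ x, 0 < f x)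
    (s : Finset δ) (x : ∀ i, X i) : 0 < lmarginal μ s f x := by
  refine (lintegral_pos_iff_support (hf.comp measurable_updateFinset)).2 ?_
  have hsupport : Function.support (f ∘ Function.updateFinset x s) = Set.univ :=
    Set.eq_univ_of_forall fun y => (hpos _).ne'
  rw [hsupport, Measure.pi_univ]
  exact pos_iff_ne_zero.2 (Finset.prod_ne_zero_iff.2 fun i _ => by simpa using hμ i)

variable [Fintype δ] {P : (∀ i, X i) → Prop}

theorem lmarginal_lmarginal_compl (hf : Measurable f) (s : Finset δ) (x : ∀ i, X i) :
    lmarginal μ s (lmarginal μ sᶜ f) x = ∫⁻ x, f x ∂Measure.pi μ := by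
  rw [← lmarginal_union μ f hf disjoint_compl_right, Finset.union_compl, lmarginal_univ]

theorem ae_of_forall_ae_updateFinset (hP : MeasurableSet {x | P x}) (s : Finset δ)
    (h : ∀ x, ∀ᵐ y ∂Measure.pi fun i : s => μ i, P (Function.updateFinset x s y)) :
    ∀ᵐ x ∂Measure.pi μ, P x := by
  have hmarginal : lmarginal μ s ({x | P x}ᶜ.indicator 1) = lmarginal μ s 0 := by
    ext x
    refine lintegral_congr_ae ((h x).mono fun y hy => ?_)
    simpa using hy
  have hint := lintegral_eq_of_lmarginal_eq s (measurable_one.indicator hP.compl)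
    measurable_zero hmarginal
  rw [lintegral_indicator_one hP.compl] at hint
  exact ae_iff.2 (by simpa using hint : Measure.pi μ {x | P x}ᶜ = 0)

theorem ae_ae_updateFinset (h : ∀ᵐ x ∂Measure.pi μ, P x) (s : Finset δ) :
    ∀ᵐ x ∂Measure.pi μ, ∀ᵐ y ∂Measure.pi fun i : s => μ i, P (Function.updateFinset x s y) := by
  obtain ⟨N, hPN, hN, hN₀⟩ := exists_measurable_superset_of_null (ae_iff.1 h)
  have hind : Measurable (N.indicator (1 : (∀ i, X i) → ℝ≥0∞)) := measurable_one.indicator hN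
  have hmarginal : lmarginal μ sᶜ (lmarginal μ s (N.indicator 1)) = lmarginal μ sᶜ 0 := by
    ext x
    have hint := lmarginal_lmarginal_compl (μ := μ) hind sᶜ x
    rw [compl_compl, lintegral_indicator_one hN, hN₀] at hint
    simpa [lmarginal] using hint
  have hint := lintegral_eq_of_lmarginal_eq sᶜ (hind.lmarginal μ) measurable_zero hmarginal
  rw [Pi.zero_def, lintegral_zero, lintegral_eq_zero_iff (hind.lmarginal μ)] at hint
  filter_upwards [hint] with x hx
  filter_upwards [(lintegral_eq_zero_iff (hind.comp measurable_updateFinset)).1 hx] with y hy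
  by_contra hn
  have hmem : Function.updateFinset x s y ∈ N := hPN hn
  simp [hmem] at hy

theorem lmarginal_congr_ae (hfg : f =ᵐ[Measure.pi μ] g) (s : Finset δ) :
    lmarginal μ s f =ᵐ[Measure.pi μ] lmarginal μ s g :=
  (ae_ae_updateFinset hfg s).mono fun _ hx => lintegral_congr_ae hx

theorem ae_lmarginal_lt_top (hf : Measurable f) (hint : ∫⁻ x, f x ∂Measure.pi μ ≠ ∞)
    (s : Finset δ) : ∀ᵐ x ∂Measure.pi μ, lmarginal μ s f x < ∞ := by
  have hm : Measurable (lmarginal μ s f) := hf.lmarginal μ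
  refine ae_of_forall_ae_updateFinset (measurableSet_lt hm measurable_const) sᶜ fun x =>
    ae_lt_top (hm.comp measurable_updateFinset) ?_
  have hx := lmarginal_lmarginal_compl (μ := μ) hf sᶜ x
  rw [compl_compl] at hx
  rw [← hx] at hint
  exact hint

end Marginals

section ConditionalDensities

variable {p : ℕ} {X : Fin p → Type*} [∀ i, MeasurableSpace (X i)]
  {μ : ∀ i, Measure (X i)} {f g : (∀ i, X i) → ℝ≥0∞} {S : Finset (Fin p)} {a b : Fin p}

theorem marginalDensity_updateFinset_singleton (ha : a ∉ S) (x : ∀ i, X i)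
    (y : ∀ i : ({a} : Finset (Fin p)), X i) :
    marginalDensity μ f S (Function.updateFinset x {a} y) = marginalDensity μ f S x := by
  refine lmarginal_congr μ f fun i hi => ?_
  have hia : i ∉ ({a} : Finset (Fin p)) := by
    rw [Finset.mem_singleton]
    rintro rfl
    exact hi (Finset.mem_compl.2 ha)
  simp [Function.updateFinset, hia]

variable [∀ i, SigmaFinite (μ i)]

theorem measurable_marginalDensity (hf : Measurable f) (A : Finset (Fin p)) :
    Measurable (marginalDensity μ f A) :=
  hf.lmarginal μ

theorem lmarginal_marginalDensity_insert (hf : Measurable f) (ha : a ∉ S) :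
    lmarginal μ {a} (marginalDensity μ f (insert a S)) = marginalDensity μ f S := by
  have hcompl : Sᶜ = {a} ∪ (insert a S)ᶜ := by
    rw [Finset.compl_insert, ← Finset.insert_eq, Finset.insert_erase (Finset.mem_compl.2 ha)]
  change lmarginal μ {a} (lmarginal μ (insert a S)ᶜ f) = lmarginal μ Sᶜ f
  rw [hcompl, lmarginal_union μ f hf (by simp)]

theorem ae_marginalDensity_ne_zero_ne_top (hμ : ∀ i, μ i ≠ 0) (hf : f ∈ PositiveDensities μ)
    (A : Finset (Fin p)) : ∀ᵐ x ∂Measure.pi μ,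
      marginalDensity μ f A x ≠ 0 ∧ marginalDensity μ f A x ≠ ∞ := by
  filter_upwards [ae_lmarginal_lt_top hf.1 (by rw [hf.2.2]; simp) Aᶜ] with x hx
  exact ⟨(lmarginal_pos hμ hf.1 (fun x => (hf.2.1 x).1) _ x).ne', hx.ne⟩

theorem condDensity_mul_condDensity_insert (hμ : ∀ i, μ i ≠ 0) (hf : f ∈ PositiveDensities μ)
    (a b : Fin p) (S : Finset (Fin p)) :
    (fun x => condDensity μ f a S x * condDensity μ f b (insert a S) x) =ᵐ[Measure.pi μ]
      fun x => marginalDensity μ f (insert b (insert a S)) x / marginalDensity μ f S x := by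
  filter_upwards [ae_marginalDensity_ne_zero_ne_top hμ hf (insert a S)] with x hx
  rw [condDensity, condDensity, mul_comm, ← mul_div_assoc, ENNReal.div_mul_cancel hx.1 hx.2]

theorem condDensity_mul_condDensity_comm (hμ : ∀ i, μ i ≠ 0) (hf : f ∈ PositiveDensities μ)
    (a b : Fin p) (S : Finset (Fin p)) :
    (fun x => condDensity μ f a S x * condDensity μ f b (insert a S) x) =ᵐ[Measure.pi μ]
      fun x => condDensity μ f b S x * condDensity μ f a (insert b S) x := by
  refine (condDensity_mul_condDensity_insert hμ hf a b S).trans ?_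
  rw [Finset.insert_comm]
  exact (condDensity_mul_condDensity_insert hμ hf b a S).symm

theorem lmarginal_condDensity_mul (hμ : ∀ i, μ i ≠ 0) (hf : f ∈ PositiveDensities μ) (hab : a ≠ b)
    (ha : a ∉ S) :
    lmarginal μ {a} (fun x => condDensity μ f a S x * condDensity μ f b (insert a S) x)
      =ᵐ[Measure.pi μ] condDensity μ f b S := by
  refine (lmarginal_congr_ae (condDensity_mul_condDensity_insert hμ hf a b S) {a}).trans ?_
  refine Filter.Eventually.of_forall fun x => ?_
  simp only [div_eq_mul_inv]
  rw [lmarginal_mul_const (g := fun x => (marginalDensity μ f S x)⁻¹)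
    (measurable_marginalDensity hf.1 _)
    (fun x y => by rw [marginalDensity_updateFinset_singleton ha]), Finset.insert_comm,
    lmarginal_marginalDensity_insert hf.1 (by simp [hab, ha])]
  rfl

theorem condDensity_ae_eq_of_chain (hμ : ∀ i, μ i ≠ 0) (hf : f ∈ PositiveDensities μ)
    (hg : g ∈ PositiveDensities μ) (hab : a ≠ b) (ha : a ∉ S)
    (h₁ : condDensity μ f a S =ᵐ[Measure.pi μ] condDensity μ g a S)
    (h₂ : condDensity μ f b (insert a S) =ᵐ[Measure.pi μ] condDensity μ g b (insert a S)) :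
    condDensity μ f b S =ᵐ[Measure.pi μ] condDensity μ g b S :=
  (lmarginal_condDensity_mul hμ hf hab ha).symm.trans
    ((lmarginal_congr_ae (h₁.mul h₂) {a}).trans (lmarginal_condDensity_mul hμ hg hab ha))

theorem condDensity_insert_ae_eq_of_chain (hμ : ∀ i, μ i ≠ 0) (hf : f ∈ PositiveDensities μ)
    (hg : g ∈ PositiveDensities μ) (hab : a ≠ b) (ha : a ∉ S)
    (h₁ : condDensity μ f a S =ᵐ[Measure.pi μ] condDensity μ g a S)
    (h₂ : condDensity μ f b (insert a S) =ᵐ[Measure.pi μ] condDensity μ g b (insert a S)) :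
    condDensity μ f a (insert b S) =ᵐ[Measure.pi μ] condDensity μ g a (insert b S) := by
  filter_upwards [condDensity_ae_eq_of_chain hμ hf hg hab ha h₁ h₂, h₁.mul h₂,
    condDensity_mul_condDensity_comm hμ hf a b S, condDensity_mul_condDensity_comm hμ hg a b S,
    ae_marginalDensity_ne_zero_ne_top hμ hg S, ae_marginalDensity_ne_zero_ne_top hμ hg (insert b S)]
    with x hb hprod hf_comm hg_comm hS hbS
  have h_ne_zero : condDensity μ g b S x ≠ 0 := ENNReal.div_ne_zero.2 ⟨hbS.1, hS.2⟩
  have h_ne_top : condDensity μ g b S x ≠ ∞ := ENNReal.div_ne_top hbS.2 hS.1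
  refine (ENNReal.mul_right_inj h_ne_zero h_ne_top).1 ?_
  calc condDensity μ g b S x * condDensity μ f a (insert b S) x
      = condDensity μ f b S x * condDensity μ f a (insert b S) x := by rw [hb]
    _ = condDensity μ f a S x * condDensity μ f b (insert a S) x := hf_comm.symm
    _ = condDensity μ g a S x * condDensity μ g b (insert a S) x := hprod
    _ = condDensity μ g b S x * condDensity μ g a (insert b S) x := hg_comm

end ConditionalDensities

namespace MixedGraph

variable {p : ℕ} {X : Fin p → Type*} [∀ i, MeasurableSpace (X i)]
  {μ : ∀ i, Measure (X i)} [∀ i, SigmaFinite (μ i)] {f : (∀ i, X i) → ℝ≥0∞}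
  {D D₁ D₂ : MixedGraph p} {a b c : Fin p} {ι : Type*} {T : ι → Finset (Fin p)}

theorem IsDAG.notMem_parents_self (hD : D.IsDAG) (a : Fin p) : a ∉ D.parents a := fun h =>
  D.ne_of_edge a a (hD.mem_parents.1 h) rfl

namespace Covered

theorem intervene (h : D.Covered a b) {I : Finset (Fin p)} (ha : a ∉ I) (hb : b ∉ I) :
    (D.intervene I).Covered a b :=
  ⟨⟨h.edge, hb⟩, fun c hc => by simp [MixedGraph.intervene, ha, hb, h.edge_iff c hc]⟩

theorem parents_eq_insert (h : D.Covered a b) (hD : D.IsDAG) :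
    D.parents b = insert a (D.parents a) := by
  ext c
  rw [Finset.mem_insert, hD.mem_parents, hD.mem_parents]
  rcases eq_or_ne c a with rfl | hc
  · simp [h.edge]
  · simp [hc, h.edge_iff c hc]

theorem parents_reverse_right (h : D.Covered a b) (hD : D.IsDAG) :
    (D.reverse a b).parents b = D.parents a := by
  ext c
  rw [(h.isDAG_reverse hD).mem_parents, hD.mem_parents]
  rcases eq_or_ne c a with rfl | hc
  · rw [reverse_edge_self]
    exact iff_of_false h.not_edge_swap fun hcc => D.ne_of_edge c c hcc rfl
  · rw [reverse_edge_of_ne (by simp [hc, (D.ne_of_edge a b h.edge).symm]), h.edge_iff c hc]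

theorem parents_reverse_left (h : D.Covered a b) (hD : D.IsDAG) :
    (D.reverse a b).parents a = insert b (D.parents a) := by
  rw [h.reverse.parents_eq_insert (h.isDAG_reverse hD), h.parents_reverse_right hD]

theorem parents_reverse_of_ne (h : D.Covered a b) (hD : D.IsDAG) (hca : c ≠ a) (hcb : c ≠ b) :
    (D.reverse a b).parents c = D.parents c := by
  ext x
  rw [(h.isDAG_reverse hD).mem_parents, hD.mem_parents, reverse_edge_of_ne (by simp [hca, hcb])]

theorem prod_condDensity_reverse (h : D.Covered a b) (hμ : ∀ i, μ i ≠ 0) (hD : D.IsDAG)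
    (hf : f ∈ PositiveDensities μ) :
    (fun x => ∏ c, condDensity μ f c ((D.reverse a b).parents c) x) =ᵐ[Measure.pi μ]
      fun x => ∏ c, condDensity μ f c (D.parents c) x := by
  filter_upwards [condDensity_mul_condDensity_comm hμ hf a b (D.parents a)] with x hx
  have hb : b ∈ Finset.univ.erase a := by simp [(D.ne_of_edge a b h.edge).symm]
  simp only [← Finset.mul_prod_erase _ _ (Finset.mem_univ a), ← Finset.mul_prod_erase _ _ hb,
    ← mul_assoc]
  rw [h.parents_reverse_left hD, h.parents_reverse_right hD, h.parents_eq_insert hD, hx,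
    mul_comm (condDensity μ f b _ x)]
  congr 1
  refine Finset.prod_congr rfl fun c hc => ?_
  simp only [Finset.mem_erase, Finset.mem_univ, and_true] at hc
  rw [h.parents_reverse_of_ne hD hc.2 hc.1]

theorem markovDensities_reverse (h : D.Covered a b) (hμ : ∀ i, μ i ≠ 0) (hD : D.IsDAG) :
    MarkovDensities μ (D.reverse a b) = MarkovDensities μ D := by
  ext f
  refine and_congr_right fun hf => ?_
  have hprod := h.prod_condDensity_reverse hμ hD hf
  exact ⟨fun h => h.trans hprod, fun h => h.trans hprod.symm⟩

theorem markovDensities_intervene_reverse (h : D.Covered a b) (hμ : ∀ i, μ i ≠ 0) (hD : D.IsDAG)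
    {I : Finset (Fin p)} (hI : a ∈ I ↔ b ∈ I) :
    MarkovDensities μ ((D.reverse a b).intervene I) = MarkovDensities μ (D.intervene I) := by
  rw [reverse_intervene hI]
  by_cases ha : a ∈ I
  · rw [reverse_eq_self_of_not_adjacent]
    exact fun hab => hab.elim (fun h => h.2 (hI.1 ha)) fun h => h.2 ha
  · exact (h.intervene ha (mt hI.2 ha)).markovDensities_reverse hμ (hD.intervene I)

theorem interventionalDensities_subset_reverse (h : D.Covered a b) (hμ : ∀ i, μ i ≠ 0)
    (hD : D.IsDAG) (hs : ¬ Separated T a b) :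
    InterventionalDensities μ T D ⊆ InterventionalDensities μ T (D.reverse a b) := by
  have hT : ∀ j, a ∈ T j ↔ b ∈ T j := not_exists_not.1 hs
  intro f hf
  refine ⟨fun j => h.markovDensities_intervene_reverse hμ hD (hT j) ▸ hf.1 j, fun j k c hc => ?_⟩
  have hfj := (hf.1 j).1
  have hfk := (hf.1 k).1
  have hab : a ∉ T j ∪ T k ↔ b ∉ T j ∪ T k := by simp [hT]
  have hchain_left : a ∉ T j ∪ T k → condDensity μ (f j) a (D.parents a) =ᵐ[Measure.pi μ]
    condDensity μ (f k) a (D.parents a) := hf.2 j k a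
  have hchain_right : b ∉ T j ∪ T k → condDensity μ (f j) b (insert a (D.parents a))
      =ᵐ[Measure.pi μ] condDensity μ (f k) b (insert a (D.parents a)) :=
    h.parents_eq_insert hD ▸ hf.2 j k b
  have hne := D.ne_of_edge a b h.edge
  have ha := hD.notMem_parents_self a
  rcases eq_or_ne c a with rfl | hca
  · rw [h.parents_reverse_left hD]
    exact condDensity_insert_ae_eq_of_chain hμ hfj hfk hne ha (hchain_left hc)
      (hchain_right (hab.1 hc))
  rcases eq_or_ne c b with rfl | hcb
  · rw [h.parents_reverse_right hD]
    exact condDensity_ae_eq_of_chain hμ hfj hfk hne ha (hchain_left (hab.2 hc)) (hchain_right hc)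
  · rw [h.parents_reverse_of_ne hD hca hcb]
    exact hf.2 j k c hc

theorem interventionallyEquivalent_reverse (h : D.Covered a b) (hμ : ∀ i, μ i ≠ 0)
    (hD : D.IsDAG) (hs : ¬ Separated T a b) : InterventionallyEquivalent μ T D (D.reverse a b) := by
  refine (h.interventionalDensities_subset_reverse hμ hD hs).antisymm ?_
  have hsubset := h.reverse.interventionalDensities_subset_reverse hμ (h.isDAG_reverse hD)
    fun h' => hs h'.symm
  rwa [reverse_comm (D.reverse a b) b a, reverse_reverse] at hsubset

end Covered

theorem GraphicallyEquivalent.interventionallyEquivalent (hμ : ∀ i, μ i ≠ 0) (h₁ : D₁.IsDAG)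
    (h₂ : D₂.IsDAG) (h : GraphicallyEquivalent T D₁ D₂) : InterventionallyEquivalent μ T D₁ D₂ := by
  suffices hboth : D₂.IsDAG ∧ InterventionallyEquivalent μ T D₁ D₂ from hboth.2
  have hchain := h.reflTransGen_coveredReversal h₁ h₂
  clear h h₂
  induction hchain with
  | refl => exact ⟨h₁, rfl⟩
  | tail _ hstep ih =>
    obtain ⟨a, b, hc, hs, rfl⟩ := hstep
    exact ⟨hc.isDAG_reverse ih.1,
      ih.2.trans (hc.interventionallyEquivalent_reverse hμ ih.1 hs)⟩

end MixedGraph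

section BalancedDensities

variable {α : Type*} [MeasurableSpace α] {μ : Measure α}

theorem exists_pos_lintegral_eq_of_sigmaFinite [SigmaFinite μ] (hμ : μ ≠ 0) {c : ℝ≥0∞}
    (hc₀ : c ≠ 0) (hc : c ≠ ∞) :
    ∃ d : α → ℝ≥0∞, Measurable d ∧ (∀ x, 0 < d x ∧ d x < ∞) ∧ ∫⁻ x, d x ∂μ = c := by
  obtain ⟨w, hpos, hw, hint⟩ := exists_pos_lintegral_lt_of_sigmaFinite μ one_ne_zero
  have hw' : Measurable fun x => (w x : ℝ≥0∞) := hw.coe_nnreal_ennreal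
  have htop : ∫⁻ x, w x ∂μ ≠ ∞ := (hint.trans ENNReal.one_lt_top).ne
  have hzero : ∫⁻ x, w x ∂μ ≠ 0 := by
    refine ((lintegral_pos_iff_support hw').2 ?_).ne'
    have hsupport : (Function.support fun x => (w x : ℝ≥0∞)) = Set.univ :=
      Set.eq_univ_of_forall fun x => ENNReal.coe_ne_zero.2 (hpos x).ne'
    simpa [hsupport, pos_iff_ne_zero] using hμ
  refine ⟨fun x => c / (∫⁻ x, w x ∂μ) * w x, hw'.const_mul _, fun x => ⟨?_, ?_⟩, ?_⟩
  · exact ENNReal.mul_pos (ENNReal.div_ne_zero.2 ⟨hc₀, htop⟩) (by simpa using (hpos x).ne')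
  · exact ENNReal.mul_lt_top (ENNReal.div_lt_top hc hzero) ENNReal.coe_lt_top
  · rw [lintegral_const_mul _ hw', ENNReal.div_mul_cancel hzero htop]

/-- A strictly positive probability density, together with a measurable set of probability one
half: a fair coin that is measurable with respect to a positive density. -/
structure BalancedDensity (μ : Measure α) where
  density : α → ℝ≥0∞
  side : Set α
  measurable_density : Measurable density
  measurableSet_side : MeasurableSet side
  pos_and_lt_top : ∀ x, 0 < density x ∧ density x < ∞
  lintegral_side : ∫⁻ x in side, density x ∂μ = 2⁻¹
  lintegral_side_compl : ∫⁻ x in sideᶜ, density x ∂μ = 2⁻¹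

namespace BalancedDensity

open Classical in
theorem nonempty [SigmaFinite μ] {A : Set α} (hA : MeasurableSet A) (h : μ A ≠ 0)
    (h' : μ Aᶜ ≠ 0) : Nonempty (BalancedDensity μ) := by
  obtain ⟨d, hd, hd_pos, hd_int⟩ := exists_pos_lintegral_eq_of_sigmaFinite (c := 2⁻¹)
    (mt Measure.restrict_eq_zero.1 h) (by simp) (by simp)
  obtain ⟨e, he, he_pos, he_int⟩ := exists_pos_lintegral_eq_of_sigmaFinite (c := 2⁻¹)
    (mt Measure.restrict_eq_zero.1 h') (by simp) (by simp)
  refine ⟨⟨A.piecewise d e, A, hd.piecewise hA he, hA, fun x => ?_, ?_, ?_⟩⟩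
  · by_cases hx : x ∈ A <;> simp [hx, hd_pos, he_pos]
  · rw [← hd_int]
    exact setLIntegral_congr_fun hA (A.piecewise_eqOn d e)
  · rw [← he_int]
    exact setLIntegral_congr_fun hA.compl (A.piecewise_eqOn_compl d e)

theorem measure_ne_zero (B : BalancedDensity μ) : μ ≠ 0 := by
  rintro rfl
  simpa using B.lintegral_side.symm

variable (B : BalancedDensity μ)

open Classical in
/-- The fair coin of a balanced density, with the values `1` and `-1`. -/
noncomputable def sign (x : α) : ℝ := if x ∈ B.side then 1 else -1

theorem abs_sign (x : α) : |B.sign x| = 1 := by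
  unfold sign
  split_ifs <;> simp

theorem measurable_sign : Measurable B.sign :=
  Measurable.ite B.measurableSet_side measurable_const measurable_const

theorem lintegral_density_mul_sign {t : ℝ} (ht : |t| ≤ 1) :
    ∫⁻ x, B.density x * ENNReal.ofReal (1 + t * B.sign x) ∂μ = 1 := by
  have hside : ∫⁻ x in B.side, B.density x * ENNReal.ofReal (1 + t * B.sign x) ∂μ
      = 2⁻¹ * ENNReal.ofReal (1 + t) := by
    rw [← B.lintegral_side, ← lintegral_mul_const _ B.measurable_density]
    exact setLIntegral_congr_fun B.measurableSet_side fun x hx => by simp [sign, hx]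
  have hcompl : ∫⁻ x in B.sideᶜ, B.density x * ENNReal.ofReal (1 + t * B.sign x) ∂μ
      = 2⁻¹ * ENNReal.ofReal (1 - t) := by
    rw [← B.lintegral_side_compl, ← lintegral_mul_const _ B.measurable_density]
    refine setLIntegral_congr_fun B.measurableSet_side.compl fun x hx => ?_
    simp [sign, show x ∉ B.side from hx, sub_eq_add_neg]
  obtain ⟨hlower, hupper⟩ := abs_le.1 ht
  rw [← lintegral_add_compl _ B.measurableSet_side, hside, hcompl, ← mul_add,
    ← ENNReal.ofReal_add (by linarith) (by linarith), add_add_sub_cancel, one_add_one_eq_two,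
    ENNReal.ofReal_ofNat, ENNReal.inv_mul_cancel (by simp) (by simp)]

theorem lintegral_density : ∫⁻ x, B.density x ∂μ = 1 := by
  simpa using B.lintegral_density_mul_sign (t := 0) (by simp)

end BalancedDensity

end BalancedDensities

section ParityDensities

variable {p : ℕ} {X : Fin p → Type*} [∀ i, MeasurableSpace (X i)] {μ : ∀ i, Measure (X i)}
  (B : ∀ i, BalancedDensity (μ i)) {Q S : Finset (Fin p)} {a : Fin p}

/-- The product of the coins that belong to the coordinates in `Q`. -/
noncomputable def parity (Q : Finset (Fin p)) (x : ∀ i, X i) : ℝ := ∏ i ∈ Q, (B i).sign (x i)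

theorem abs_parity (x : ∀ i, X i) : |parity B Q x| = 1 := by
  simp [parity, Finset.abs_prod, BalancedDensity.abs_sign]

theorem measurable_parity : Measurable (parity B Q) :=
  Finset.measurable_prod _ fun i _ => (B i).measurable_sign.comp (measurable_pi_apply i)

theorem parity_update_of_mem (ha : a ∈ Q) (x : ∀ i, X i) (y : X a) :
    parity B Q (Function.update x a y) = parity B (Q.erase a) x * (B a).sign y := by
  rw [parity, ← Finset.prod_erase_mul _ _ ha, Function.update_self]
  congr 1
  exact Finset.prod_congr rfl fun i hi => by rw [Function.update_of_ne (Finset.ne_of_mem_erase hi)]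

theorem parity_update_of_notMem (ha : a ∉ Q) (x : ∀ i, X i) (y : X a) :
    parity B Q (Function.update x a y) = parity B Q x :=
  Finset.prod_congr rfl fun i hi => by rw [Function.update_of_ne (ne_of_mem_of_not_mem hi ha)]

/-- The density of the interaction of the variables in `Q`, with respect to a law under which they
are independent; the factor `1 / 2` keeps it positive. -/
noncomputable def parityWeight (Q : Finset (Fin p)) (x : ∀ i, X i) : ℝ≥0∞ :=
  ENNReal.ofReal (1 + 1 / 2 * parity B Q x)

theorem measurable_parityWeight : Measurable (parityWeight B Q) :=
  (((measurable_parity B).const_mul _).const_add _).ennreal_ofReal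

theorem parityWeight_pos (x : ∀ i, X i) : 0 < parityWeight B Q x := by
  have hparity := (abs_le.1 (abs_parity B (Q := Q) x).le).1
  exact ENNReal.ofReal_pos.2 (by linarith)

theorem parityWeight_ne_one (x : ∀ i, X i) : parityWeight B Q x ≠ 1 := by
  have hparity : parity B Q x ≠ 0 := fun h => by simpa [h] using abs_parity B (Q := Q) x
  simpa [parityWeight] using hparity

theorem lintegral_density_mul_parityWeight (x : ∀ i, X i) :
    ∫⁻ y, (B a).density y * parityWeight B Q (Function.update x a y) ∂μ a =
      if a ∈ Q then 1 else parityWeight B Q x := by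
  simp only [parityWeight]
  split_ifs with ha
  · simp only [parity_update_of_mem B ha, ← mul_assoc]
    exact (B a).lintegral_density_mul_sign (by rw [abs_mul, abs_parity]; norm_num)
  · simp only [parity_update_of_notMem B ha]
    rw [lintegral_mul_const _ (B a).measurable_density, (B a).lintegral_density, one_mul]

/-- A product density, perturbed by an interaction of the variables in `Q`. -/
noncomputable def parityDensity (Q : Finset (Fin p)) (x : ∀ i, X i) : ℝ≥0∞ :=
  (∏ i, (B i).density (x i)) * parityWeight B Q x

theorem measurable_parityDensity : Measurable (parityDensity B Q) :=
  (Finset.measurable_prod _ fun i _ => (B i).measurable_density.comp (measurable_pi_apply i)).mul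
    (measurable_parityWeight B)

theorem prod_density_ne_zero (S : Finset (Fin p)) (x : ∀ i, X i) :
    ∏ i ∈ S, (B i).density (x i) ≠ 0 :=
  Finset.prod_ne_zero_iff.2 fun i _ => ((B i).pos_and_lt_top _).1.ne'

theorem prod_density_ne_top (S : Finset (Fin p)) (x : ∀ i, X i) :
    ∏ i ∈ S, (B i).density (x i) ≠ ∞ :=
  ENNReal.prod_ne_top fun i _ => ((B i).pos_and_lt_top _).2.ne

theorem prod_density_compl_update {s : Finset (Fin p)} (ha : a ∉ s) (x : ∀ i, X i) (y : X a) :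
    ∏ i ∈ sᶜ, (B i).density (Function.update x a y i) =
      (∏ i ∈ (insert a s)ᶜ, (B i).density (x i)) * (B a).density y := by
  rw [← Finset.prod_erase_mul _ _ (Finset.mem_compl.2 ha), Function.update_self,
    Finset.compl_insert]
  congr 1
  exact Finset.prod_congr rfl fun i hi => by rw [Function.update_of_ne (Finset.ne_of_mem_erase hi)]

variable [∀ i, SigmaFinite (μ i)]

theorem lmarginal_parityDensity (s : Finset (Fin p)) (x : ∀ i, X i) :
    lmarginal μ s (parityDensity B Q) x =
      (∏ i ∈ sᶜ, (B i).density (x i)) * if Disjoint s Q then parityWeight B Q x else 1 := by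
  induction s using Finset.induction_on generalizing x with
  | empty => simp [parityDensity]
  | insert a s ha ih =>
    rw [lmarginal_insert _ (measurable_parityDensity B) ha]
    simp only [ih, prod_density_compl_update B ha, mul_assoc]
    rw [lintegral_const_mul' _ _ (prod_density_ne_top B _ x)]
    congr 1
    by_cases hsQ : Disjoint s Q
    · simp only [hsQ, if_true, lintegral_density_mul_parityWeight, Finset.disjoint_insert_left,
        and_true, ite_not]
    · simp [hsQ, (B a).lintegral_density]

theorem marginalDensity_parityDensity (S : Finset (Fin p)) (x : ∀ i, X i) :
    marginalDensity μ (parityDensity B Q) S x =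
      (∏ i ∈ S, (B i).density (x i)) * if Q ⊆ S then parityWeight B Q x else 1 := by
  rw [marginalDensity, lmarginal_parityDensity, compl_compl]
  simp only [disjoint_comm (a := Sᶜ), disjoint_compl_right_iff]

theorem condDensity_parityDensity (ha : a ∉ S) (x : ∀ i, X i) :
    condDensity μ (parityDensity B Q) a S x =
      (B a).density (x a) * if a ∈ Q ∧ Q ⊆ insert a S then parityWeight B Q x else 1 := by
  have hcancel : ∀ d w r : ℝ≥0∞, d * (∏ i ∈ S, (B i).density (x i)) * w /
      ((∏ i ∈ S, (B i).density (x i)) * r) = d * (w / r) := fun d w r => by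
    rw [mul_comm d, mul_assoc, ENNReal.mul_div_mul_left _ _ (prod_density_ne_zero B S x)
      (prod_density_ne_top B S x), mul_div_assoc]
  rw [condDensity, marginalDensity_parityDensity, marginalDensity_parityDensity,
    Finset.prod_insert ha, hcancel]
  congr 1
  by_cases haQ : a ∈ Q
  · have hQS : ¬ Q ⊆ S := fun h => ha (h haQ)
    simp [haQ, hQS]
  · simp only [Finset.subset_insert_iff_of_notMem haQ, haQ, false_and, if_false]
    split_ifs
    · exact ENNReal.div_self (parityWeight_pos B x).ne' ENNReal.ofReal_ne_top
    · exact div_one 1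

theorem parityDensity_mem_positiveDensities (hQ : Q.Nonempty) :
    parityDensity B Q ∈ PositiveDensities μ := by
  refine ⟨measurable_parityDensity B, fun x => ⟨?_, ?_⟩, ?_⟩
  · exact ENNReal.mul_pos (prod_density_ne_zero B _ x) (parityWeight_pos B x).ne'
  · exact ENNReal.mul_lt_top (prod_density_ne_top B _ x).lt_top ENNReal.ofReal_lt_top
  · have (i : Fin p) : NeZero (μ i) := ⟨(B i).measure_ne_zero⟩
    have (i : Fin p) : Nonempty (X i) := (μ i).nonempty_of_neZero
    rw [lintegral_eq_lmarginal_univ (fun i => Classical.arbitrary (X i)),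
      lmarginal_parityDensity]
    simp [← Finset.top_eq_univ, hQ.ne_empty]

end ParityDensities

namespace MixedGraph

variable {p : ℕ} {G D D' D₁ D₂ : MixedGraph p} {Q : Finset (Fin p)} {a b c : Fin p} {ι : Type*}
  {T : ι → Finset (Fin p)}

/-- All vertices of `Q` except `c ∈ Q` are parents of `c` in the DAG `D`. -/
def IsCommonChild (D : MixedGraph p) (Q : Finset (Fin p)) (c : Fin p) : Prop :=
  c ∈ Q ∧ ∀ x ∈ Q, x ≠ c → D.Edge x c

theorem IsCommonChild.eq (hD : D.IsDAG) (ha : D.IsCommonChild Q a) (hb : D.IsCommonChild Q b) :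
    a = b := by
  by_contra hab
  exact hD.asymm (ha.2 b hb.1 (Ne.symm hab)) (hb.2 a ha.1 hab)

theorem isCommonChild_singleton (D : MixedGraph p) (c : Fin p) : D.IsCommonChild {c} c :=
  ⟨Finset.mem_singleton_self c, fun _ hx hxc => absurd (Finset.mem_singleton.1 hx) hxc⟩

theorem isCommonChild_pair (hab : D.Edge a b) : D.IsCommonChild {a, b} b := by
  simp [IsCommonChild, hab]

theorem VStructure.isCommonChild (h : D.VStructure a b c) : D.IsCommonChild {a, b, c} b := by
  simp [IsCommonChild, h.left, h.right]

theorem IsCommonChild.intervene (h : D.IsCommonChild Q c) {I : Finset (Fin p)} (hc : c ∉ I) :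
    (D.intervene I).IsCommonChild Q c :=
  h.imp_right fun h x hx hxc => ⟨h x hx hxc, hc⟩

theorem IsCommonChild.of_intervene {I : Finset (Fin p)} (h : (D.intervene I).IsCommonChild Q c) :
    D.IsCommonChild Q c :=
  h.imp_right fun h x hx hxc => (h x hx hxc).1

theorem IsDAG.isCommonChild_iff (hD : D.IsDAG) :
    D.IsCommonChild Q c ↔ c ∈ Q ∧ Q ⊆ insert c (D.parents c) := by
  simp only [IsCommonChild, Finset.subset_iff, Finset.mem_insert, hD.mem_parents,
    or_iff_not_imp_left]

section Densities

variable {X : Fin p → Type*} [∀ i, MeasurableSpace (X i)] {μ : ∀ i, Measure (X i)}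
  [∀ i, SigmaFinite (μ i)] (B : ∀ i, BalancedDensity (μ i))

open Classical in
theorem IsDAG.condDensity_parityDensity (hD : D.IsDAG) (x : ∀ i, X i) :
    condDensity μ (parityDensity B Q) a (D.parents a) x =
      (B a).density (x a) * if D.IsCommonChild Q a then parityWeight B Q x else 1 := by
  rw [_root_.condDensity_parityDensity B (hD.notMem_parents_self a)]
  simp only [hD.isCommonChild_iff]

theorem IsDAG.parityDensity_mem_markovDensities_iff (hD : D.IsDAG) (hQ : Q.Nonempty) :
    parityDensity B Q ∈ MarkovDensities μ D ↔ ∃ c, D.IsCommonChild Q c := by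
  classical
  have hprod : ∀ x, ∏ a, condDensity μ (parityDensity B Q) a (D.parents a) x =
      (∏ a, (B a).density (x a)) *
        ∏ a, if D.IsCommonChild Q a then parityWeight B Q x else 1 := fun x => by
    simp only [hD.condDensity_parityDensity, Finset.prod_mul_distrib]
  constructor
  · rintro ⟨-, hfactor⟩
    by_contra! hn
    have hpi : Measure.pi μ ≠ 0 := by
      simp [← Measure.measure_univ_ne_zero, Measure.pi_univ, Finset.prod_ne_zero_iff,
        (B _).measure_ne_zero]
    have := ae_neBot.2 hpi
    obtain ⟨x, hx⟩ := hfactor.exists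
    simp only [hprod, hn, if_false, Finset.prod_const_one] at hx
    exact parityWeight_ne_one B x
      ((ENNReal.mul_right_inj (prod_density_ne_zero B _ x) (prod_density_ne_top B _ x)).1 hx)
  · rintro ⟨c, hc⟩
    refine ⟨parityDensity_mem_positiveDensities B hQ, .of_forall fun x => ?_⟩
    have hiff : ∀ a, D.IsCommonChild Q a ↔ a = c := fun a =>
      ⟨fun ha => ha.eq hD hc, fun hac => hac ▸ hc⟩
    simp [hprod, hiff, parityDensity]

open Classical in
/-- The parity densities of `Q`, where a target that contains `c` switches the interaction off by
replacing `Q` with `{c}`. -/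
noncomputable def parityTuple (T : ι → Finset (Fin p)) (c : Fin p) (Q : Finset (Fin p)) (j : ι) :
    (∀ i, X i) → ℝ≥0∞ :=
  parityDensity B (if c ∈ T j then {c} else Q)

theorem IsCommonChild.parityTuple_mem_interventionalDensities (hD : D.IsDAG)
    (hc : D.IsCommonChild Q c) : parityTuple B T c Q ∈ InterventionalDensities μ T D := by
  refine ⟨fun j => ?_, fun j k a ha => ?_⟩
  · have hc' : (D.intervene (T j)).IsCommonChild (if c ∈ T j then {c} else Q) c := by
      split_ifs with hj
      exacts [isCommonChild_singleton _ c, hc.intervene hj]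
    exact ((hD.intervene (T j)).parityDensity_mem_markovDensities_iff B ⟨c, hc'.1⟩).2 ⟨c, hc'⟩
  · rcases eq_or_ne a c with rfl | hac
    · simp only [Finset.mem_union, not_or] at ha
      simp [parityTuple, ha]
    · have hcond : ∀ l, condDensity μ (parityTuple B T c Q l) a (D.parents a) =
          fun x => (B a).density (x a) := fun l => by
        have hc' : D.IsCommonChild (if c ∈ T l then {c} else Q) c := by
          split_ifs
          exacts [isCommonChild_singleton _ c, hc]
        ext x
        rw [parityTuple, hD.condDensity_parityDensity, if_neg fun ha => hac (ha.eq hD hc'),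
          mul_one]
      rw [hcond, hcond]

end Densities

end MixedGraph

namespace InterventionallyEquivalent

open MixedGraph

variable {p : ℕ} {ι : Type*} {T : ι → Finset (Fin p)} {D₁ D₂ : MixedGraph p} {a b c : Fin p}

protected theorem symm {X : Fin p → Type*} [∀ i, MeasurableSpace (X i)] {μ : ∀ i, Measure (X i)}
    (h : InterventionallyEquivalent μ T D₁ D₂) : InterventionallyEquivalent μ T D₂ D₁ :=
  Eq.symm h

variable {X : Fin p → Type*} [∀ i, MeasurableSpace (X i)] {μ : ∀ i, Measure (X i)}
  [∀ i, SigmaFinite (μ i)] (B : ∀ i, BalancedDensity (μ i))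

include B

theorem exists_isCommonChild (h : InterventionallyEquivalent μ T D₁ D₂) (h₁ : D₁.IsDAG)
    (h₂ : D₂.IsDAG) {Q : Finset (Fin p)} (hc : D₁.IsCommonChild Q c) {j : ι} (hj : c ∉ T j) :
    ∃ a, (D₂.intervene (T j)).IsCommonChild Q a := by
  have hmem : parityTuple B T c Q ∈ InterventionalDensities μ T D₂ :=
    h ▸ hc.parityTuple_mem_interventionalDensities B h₁
  have hmem_j := hmem.1 j
  rw [parityTuple, if_neg hj] at hmem_j
  exact ((h₂.intervene _).parityDensity_mem_markovDensities_iff B ⟨c, hc.1⟩).1 hmem_j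

theorem adjacent_intervene (h : InterventionallyEquivalent μ T D₁ D₂) (h₁ : D₁.IsDAG)
    (h₂ : D₂.IsDAG) (hab : D₁.Edge a b) {j : ι} (hj : b ∉ T j) :
    (D₂.intervene (T j)).Adjacent a b := by
  have hne := D₁.ne_of_edge a b hab
  obtain ⟨c, hc, hedge⟩ := h.exists_isCommonChild B h₁ h₂ (isCommonChild_pair hab) hj
  rcases Finset.mem_insert.1 hc with rfl | hc
  · exact Or.inr (hedge b (by simp) hne.symm)
  · rw [Finset.mem_singleton] at hc
    subst hc
    exact Or.inl (hedge a (by simp) hne)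

theorem adjacent (h : InterventionallyEquivalent μ T D₁ D₂) (hT : IsConservative T)
    (h₁ : D₁.IsDAG) (h₂ : D₂.IsDAG) (hab : D₁.Adjacent a b) : D₂.Adjacent a b := by
  have of_edge : ∀ {a b}, D₁.Edge a b → D₂.Adjacent a b := fun {a b} hab => by
    obtain ⟨j, hj⟩ := hT b
    exact (h.adjacent_intervene B h₁ h₂ hab hj).imp And.left And.left
  exact hab.elim of_edge fun hba => (of_edge hba).symm

theorem vStructure (h : InterventionallyEquivalent μ T D₁ D₂) (hT : IsConservative T)
    (h₁ : D₁.IsDAG) (h₂ : D₂.IsDAG) (hv : D₁.VStructure a b c) : D₂.VStructure a b c := by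
  have hac : ¬ D₂.Adjacent a c := fun hac => hv.not_adjacent (h.symm.adjacent B hT h₂ h₁ hac)
  obtain ⟨j, hj⟩ := hT b
  obtain ⟨d, hd⟩ := h.exists_isCommonChild B h₁ h₂ hv.isCommonChild hj
  have hedge := hd.of_intervene.2
  have hd_mem := hd.1
  simp only [Finset.mem_insert, Finset.mem_singleton] at hd_mem
  rcases hd_mem with rfl | rfl | rfl
  · exact absurd (Or.inr (hedge c (by simp) hv.ne.symm)) hac
  · exact ⟨hedge a (by simp) (D₁.ne_of_edge _ _ hv.left),
      hedge c (by simp) (D₁.ne_of_edge _ _ hv.right), hv.ne, hac⟩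
  · exact absurd (Or.inl (hedge a (by simp) hv.ne)) hac

theorem edge_of_separated (h : InterventionallyEquivalent μ T D₁ D₂) (hT : IsConservative T)
    (h₁ : D₁.IsDAG) (h₂ : D₂.IsDAG) (hab : D₁.Edge a b) (hs : Separated T a b) : D₂.Edge a b := by
  obtain ⟨j, hj⟩ := hs
  by_cases hb : b ∈ T j
  · have ha : a ∉ T j := fun ha => hj (iff_of_true ha hb)
    refine (h.adjacent B hT h₁ h₂ (Or.inl hab)).resolve_right fun hba => ?_
    exact (h.symm.adjacent_intervene B h₂ h₁ hba ha).elim (fun h' => h₁.asymm hab h'.1)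
      fun h' => h'.2 hb
  · exact ((h.adjacent_intervene B h₁ h₂ hab hb).resolve_right fun hba =>
      hj (iff_of_false hba.2 hb)).1

theorem graphicallyEquivalent (h : InterventionallyEquivalent μ T D₁ D₂)
    (hT : IsConservative T) (h₁ : D₁.IsDAG) (h₂ : D₂.IsDAG) : GraphicallyEquivalent T D₁ D₂ where
  adjacent_iff _ _ := ⟨h.adjacent B hT h₁ h₂, h.symm.adjacent B hT h₂ h₁⟩
  vStructure_iff _ _ _ := ⟨h.vStructure B hT h₁ h₂, h.symm.vStructure B hT h₂ h₁⟩
  edge_iff_of_separated _ _ hs :=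
    ⟨(h.edge_of_separated B hT h₁ h₂ · hs), (h.symm.edge_of_separated B hT h₂ h₁ · hs)⟩

end InterventionallyEquivalent

theorem essentialGraph_eq_completedPattern {p : ℕ} {ι : Type*} {T : ι → Finset (Fin p)}
    {D : MixedGraph p} {X : Fin p → Type*} [∀ i, MeasurableSpace (X i)]
    {μ : ∀ i, Measure (X i)} [∀ i, SigmaFinite (μ i)] (B : ∀ i, BalancedDensity (μ i))
    (hT : IsConservative T) (hD : D.IsDAG) : essentialGraph μ T D = D.completedPattern T := by
  ext a b
  rw [MixedGraph.completedPattern_edge_iff hD]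
  refine exists_congr fun D' => and_congr_right fun hD' => and_congr_left fun _ => ?_
  exact ⟨fun h => h.graphicallyEquivalent B hT hD' hD,
    fun h => h.interventionallyEquivalent (fun i => (B i).measure_ne_zero) hD' hD⟩

namespace MixedGraph

variable {p : ℕ} {ι : Type*} {T : ι → Finset (Fin p)} {D G : MixedGraph p} {a b c d : Fin p}

theorem card_inter_pair_eq_one_iff (hab : a ≠ b) (s : Finset (Fin p)) :
    (s ∩ {a, b}).card = 1 ↔ ¬ (a ∈ s ↔ b ∈ s) := by
  by_cases ha : a ∈ s <;> by_cases hb : b ∈ s <;>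
    simp [Finset.inter_insert_of_mem, Finset.inter_insert_of_notMem,
      Finset.inter_singleton_of_mem, Finset.inter_singleton_of_notMem, ha, hb, hab]

theorem separated_iff_exists_card (hab : a ≠ b) :
    Separated T a b ↔ ∃ j, (T j ∩ {a, b}).card = 1 :=
  exists_congr fun _ => (card_inter_pair_eq_one_iff hab _).symm

theorem Adjacent.line_of_not_arrow (h : G.Adjacent a b) (hab : ¬ G.Arrow a b)
    (hba : ¬ G.Arrow b a) : G.Line a b :=
  h.elim (fun h => ⟨h, not_not.1 fun h' => hab ⟨h, h'⟩⟩)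
    fun h => ⟨not_not.1 fun h' => hba ⟨h, h'⟩, h⟩

theorem adjacent_iff_of_between (hDG : D ≤ G) (hG : G ≤ D.completedPattern T) :
    G.Adjacent a b ↔ D.Adjacent a b :=
  ⟨fun h => h.elim (fun h => (hG _ _ h).1) fun h => (hG _ _ h).1.symm,
    fun h => h.imp (hDG _ _) (hDG _ _)⟩

theorem edge_of_arrow_of_between (hDG : D ≤ G) (hG : G ≤ D.completedPattern T)
    (h : G.Arrow a b) : D.Edge a b :=
  (hG _ _ h.1).1.resolve_right fun hba => h.2 (hDG _ _ hba)

theorem Compelled.arrow_of_between (hDG : D ≤ G) (hG : G ≤ D.completedPattern T)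
    (h : Compelled T D a b) : G.Arrow a b :=
  ⟨hDG _ _ h.edge, fun hba => (hG _ _ hba).2 h⟩

/-- In a topological order of `D`, choose a non-compelled arrow with the first possible head and,
given the head, the last possible tail: the arrows that protect it are then compelled. -/
theorem compelled_of_arrow_of_allArrowsProtected (hD : D.IsDAG) (hDG : D ≤ G)
    (hG : G ≤ D.completedPattern T) (hprot : AllArrowsProtected T G) (hab : G.Arrow a b) :
    Compelled T D a b := by
  obtain ⟨r, hr⟩ := hD.exists_rank
  have hedge : ∀ {x y}, G.Arrow x y → D.Edge x y := edge_of_arrow_of_between hDG hG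
  have hadj : ∀ {x y}, G.Adjacent x y ↔ D.Adjacent x y := adjacent_iff_of_between hDG hG
  by_contra hn
  obtain ⟨a, b, ⟨hab, hn⟩, hmin, hmax⟩ := exists_rel_min_snd_max_fst
    (P := fun x y => G.Arrow x y ∧ ¬ Compelled T D x y) r ⟨hab, hn⟩
  have hearlier : ∀ {x y}, G.Arrow x y → r y < r b → Compelled T D x y := fun hxy hy =>
    not_not.1 fun h => (hmin _ _ ⟨hxy, h⟩).not_gt hy
  have hlater : ∀ {x}, G.Arrow x b → r a < r x → Compelled T D x b := fun hxb hx =>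
    not_not.1 fun h => (hmax _ ⟨hxb, h⟩).not_gt hx
  refine hn ?_
  rcases hprot a b hab with hs | ⟨c, hca, -, hcb⟩ | ⟨c, hcb, hne, hca⟩ | ⟨c, hac, hcb⟩ |
    ⟨c₁, c₂, hl₁, hl₂, h₁, h₂, hne, hc⟩
  · exact .separated (hedge hab) ((separated_iff_exists_card hab.ne).2 hs)
  · exact (hearlier hca (hr _ _ (hedge hab))).away (hedge hab) (mt hadj.2 hcb)
  · exact .collider ⟨hedge hab, hedge hcb, hne.symm, fun h => hca (hadj.2 h.symm)⟩
  · exact (hearlier hac (hr _ _ (hedge hcb))).path (hlater hcb (hr _ _ (hedge hac))) (hedge hab)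
  · exact .diamond ⟨hedge h₁, hedge h₂, hne, mt hadj.2 hc⟩ (hedge hab) (hG _ _ hl₁.1).1
      (hG _ _ hl₂.1).1 fun hv => (hG _ _ hl₁.1).2 (.collider hv)

theorem eq_completedPattern_of_allArrowsProtected (hD : D.IsDAG) (hDG : D ≤ G)
    (hG : G ≤ D.completedPattern T) (hprot : AllArrowsProtected T G) :
    G = D.completedPattern T := by
  ext a b
  refine ⟨hG a b, fun hab => not_not.1 fun hn => hab.2 ?_⟩
  have hba : G.Edge b a := ((adjacent_iff_of_between hDG hG).2 hab.1).resolve_left hn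
  exact compelled_of_arrow_of_allArrowsProtected hD hDG hG hprot ⟨hba, hn⟩

/-- The graphical counterpart of a partial essential graph. -/
structure IsPartialPattern (T : ι → Finset (Fin p)) (D G : MixedGraph p) : Prop where
  le : D ≤ G
  le_completedPattern : G ≤ D.completedPattern T
  adjacent_of_arrow_of_line : ∀ ⦃a b c⦄, G.Arrow a b → G.Line b c → G.Adjacent a c

theorem isPartialPattern_completedPattern (hD : D.IsDAG) :
    IsPartialPattern T D (D.completedPattern T) where
  le := le_completedPattern hD
  le_completedPattern _ _ h := h
  adjacent_of_arrow_of_line a b c hab hbc := by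
    rw [arrow_completedPattern_iff hD] at hab
    rw [line_completedPattern_iff] at hbc
    exact Or.inl (le_completedPattern hD a c (hab.of_free hD hbc).edge)

namespace IsPartialPattern

theorem not_arrow_of_not_vStructure (hG : IsPartialPattern T D G) (hcd : c ≠ d)
    (hn : ¬ D.Adjacent c d) (had : D.Adjacent a d) (hnad : ¬ G.Arrow a d)
    (ha : ¬ D.VStructure c a d) : ¬ G.Arrow c a := fun hca => by
  have hadj : ∀ {x y}, G.Adjacent x y ↔ D.Adjacent x y :=
    adjacent_iff_of_between hG.le hG.le_completedPattern
  have hedge : ∀ {x y}, G.Arrow x y → D.Edge x y :=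
    edge_of_arrow_of_between hG.le hG.le_completedPattern
  have hline : G.Line a d := (hadj.2 had).line_of_not_arrow hnad fun hda =>
    ha ⟨hedge hca, hedge hda, hcd, hn⟩
  exact hn (hadj.1 (hG.adjacent_of_arrow_of_line hca hline))

theorem stronglyProtected_of_compelled (hD : D.IsDAG) (hG : IsPartialPattern T D G)
    (h : Compelled T D a b) : StronglyProtected T G a b := by
  have harrow : ∀ {x y}, Compelled T D x y → G.Arrow x y :=
    Compelled.arrow_of_between hG.le hG.le_completedPattern
  have hadj : ∀ {x y}, G.Adjacent x y ↔ D.Adjacent x y :=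
    adjacent_iff_of_between hG.le hG.le_completedPattern
  cases h with
  | separated hab hs => exact Or.inl ((separated_iff_exists_card (D.ne_of_edge _ _ hab)).1 hs)
  | @collider _ _ c hv =>
    exact Or.inr (Or.inr (Or.inl ⟨c, harrow (.collider hv.symm), hv.ne.symm,
      mt hadj.1 hv.symm.not_adjacent⟩))
  | @away _ _ c hca hab hcb =>
    refine Or.inr (Or.inl ⟨c, harrow hca, ?_, mt hadj.1 hcb⟩)
    rintro rfl
    exact hD.asymm hab hca.edge
  | @path _ _ c hac hcb _ => exact Or.inr (Or.inr (Or.inr (Or.inl ⟨c, harrow hac, harrow hcb⟩)))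
  | @diamond _ _ c₁ c₂ hv _ h₁ h₂ ha =>
    have hc₁ : G.Arrow c₁ b := harrow (.collider hv)
    have hc₂ : G.Arrow c₂ b := harrow (.collider hv.symm)
    by_cases ha₁ : G.Arrow a c₁
    · exact Or.inr (Or.inr (Or.inr (Or.inl ⟨c₁, ha₁, hc₁⟩)))
    by_cases ha₂ : G.Arrow a c₂
    · exact Or.inr (Or.inr (Or.inr (Or.inl ⟨c₂, ha₂, hc₂⟩)))
    have hl₁ : G.Line a c₁ := (hadj.2 h₁).line_of_not_arrow ha₁
      (hG.not_arrow_of_not_vStructure hv.ne hv.not_adjacent h₂ ha₂ ha)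
    have hl₂ : G.Line a c₂ := (hadj.2 h₂).line_of_not_arrow ha₂
      (hG.not_arrow_of_not_vStructure hv.symm.ne hv.symm.not_adjacent h₁ ha₁ fun h => ha h.symm)
    exact Or.inr (Or.inr (Or.inr (Or.inr ⟨c₁, c₂, hl₁, hl₂, hc₁, hc₂, hv.ne,
      mt hadj.1 hv.not_adjacent⟩)))

theorem allArrowsProtected_iff (hD : D.IsDAG) (hG : IsPartialPattern T D G) :
    AllArrowsProtected T G ↔ G = D.completedPattern T := by
  refine ⟨eq_completedPattern_of_allArrowsProtected hD hG.le hG.le_completedPattern, ?_⟩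
  rintro rfl a b hab
  exact hG.stronglyProtected_of_compelled hD ((arrow_completedPattern_iff hD).1 hab)

theorem addEdge (hD : D.IsDAG) (hG : IsPartialPattern T D G) (hab : G.Arrow a b)
    (hnot : ¬ StronglyProtected T G a b) :
    IsPartialPattern T D (G.addEdge b a hab.ne.symm) where
  le x y h := Or.inl (hG.le x y h)
  le_completedPattern := by
    rintro x y (h | ⟨rfl, rfl⟩)
    · exact hG.le_completedPattern x y h
    · exact ⟨(hG.le_completedPattern _ _ hab.1).1.symm,
        fun h => hnot (hG.stronglyProtected_of_compelled hD h)⟩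
  adjacent_of_arrow_of_line x y z := by
    rintro ⟨hxy, hyx⟩ ⟨hyz, hzy⟩
    by_contra hn
    simp only [MixedGraph.addEdge, not_or] at hxy hyx hyz hzy
    have hxy' : G.Arrow x y := by
      refine ⟨hxy.resolve_right ?_, hyx.1⟩
      rintro ⟨rfl, rfl⟩
      exact hyx.1 hab.1
    have hxz : ¬ G.Adjacent x z := fun h => hn (h.imp Or.inl Or.inl)
    by_cases hyz_eq : y = a ∧ z = b
    · obtain ⟨rfl, rfl⟩ := hyz_eq
      refine hnot (Or.inr (Or.inl ⟨x, hxy', ?_, hxz⟩))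
      rintro rfl
      exact hxy'.2 hab.1
    by_cases hzy_eq : y = b ∧ z = a
    · obtain ⟨rfl, rfl⟩ := hzy_eq
      refine hnot (Or.inr (Or.inr (Or.inl ⟨x, hxy', ?_, hxz⟩)))
      rintro rfl
      exact hyx.2 ⟨rfl, rfl⟩
    have hline : G.Line y z :=
      ⟨hyz.resolve_right hzy_eq, hzy.resolve_right fun h => hyz_eq h.symm⟩
    exact hxz (hG.adjacent_of_arrow_of_line hxy' hline)

end IsPartialPattern

theorem numArrows_addEdge_lt (hab : G.Arrow a b) :
    (G.addEdge b a hab.ne.symm).numArrows < G.numArrows := by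
  classical
  refine Finset.card_lt_card (Finset.ssubset_iff_of_subset ?_ |>.2 ⟨(a, b), ?_, ?_⟩)
  · rintro ⟨x, y⟩ hxy
    rw [Finset.mem_filter_univ] at hxy ⊢
    simp only [Arrow, addEdge, not_or] at hxy ⊢
    rcases hxy with ⟨h | ⟨rfl, rfl⟩, h', -⟩
    · exact ⟨h, h'⟩
    · exact absurd hab.1 h'
  · simpa using hab
  · rw [Finset.mem_filter_univ]
    simp [Arrow, addEdge]

end MixedGraph

section Runs

open MixedGraph

variable {p : ℕ} {ι : Type*} {T : ι → Finset (Fin p)} {D G H : MixedGraph p} {n : ℕ}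

theorem ReplaceUnprotectedRun.isPartialPattern (hD : D.IsDAG) (h : ReplaceUnprotectedRun T n G H)
    (hG : IsPartialPattern T D G) : IsPartialPattern T D H := by
  induction h with
  | start => exact hG
  | pass hab hnot _ ih => exact ih (hG.addEdge hD hab hnot)

theorem ReplaceUnprotectedRun.le_numArrows (h : ReplaceUnprotectedRun T n G H) :
    n ≤ G.numArrows := by
  induction h with
  | start => exact Nat.zero_le _
  | pass hab _ _ ih => exact ih.trans_lt (numArrows_addEdge_lt hab)

theorem exists_replaceUnprotectedReturns (T : ι → Finset (Fin p)) (G : MixedGraph p) :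
    ∃ H, ReplaceUnprotectedReturns T G H := by
  induction hn : G.numArrows using Nat.strong_induction_on generalizing G with
  | _ n ih =>
    by_cases hG : AllArrowsProtected T G
    · exact ⟨G, ⟨0, .start G⟩, hG⟩
    · simp only [AllArrowsProtected, not_forall] at hG
      obtain ⟨a, b, hab, hnot⟩ := hG
      obtain ⟨H, ⟨m, hm⟩, hH⟩ := ih _ (hn ▸ numArrows_addEdge_lt hab) _ rfl
      exact ⟨H, ⟨m + 1, .pass hab hnot hm⟩, hH⟩

theorem replaceUnprotectedReturns_iff (hD : D.IsDAG) (hG : IsPartialPattern T D G) :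
    ReplaceUnprotectedReturns T G H ↔ H = D.completedPattern T := by
  have hreturn : ∀ {K}, ReplaceUnprotectedReturns T G K → K = D.completedPattern T :=
    fun ⟨⟨_, hrun⟩, hK⟩ => ((hrun.isPartialPattern hD hG).allArrowsProtected_iff hD).1 hK
  refine ⟨hreturn, ?_⟩
  rintro rfl
  obtain ⟨K, hK⟩ := exists_replaceUnprotectedReturns T G
  exact hreturn hK ▸ hK

end Runs

theorem isPartialEssential_iff {p : ℕ} {X : Fin p → Type*} [∀ i, MeasurableSpace (X i)]
    {μ : ∀ i, Measure (X i)} {ι : Type*} {T : ι → Finset (Fin p)} {D G : MixedGraph p}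
    (h : essentialGraph μ T D = D.completedPattern T) :
    IsPartialEssential μ T D G ↔ MixedGraph.IsPartialPattern T D G := by
  constructor
  · rintro ⟨hDG, hG, hflag⟩
    refine ⟨hDG, h ▸ hG, fun a b c hab hbc => ?_⟩
    by_contra hac
    exact hflag ⟨a, b, c, hab, hbc, hac⟩
  · rintro ⟨hDG, hG, hflag⟩
    exact ⟨hDG, h ▸ hG, fun ⟨_, _, _, hab, hbc, hac⟩ => hac (hflag hab hbc)⟩

theorem mainTheorem5 {p : ℕ} {X : Fin p → Type*} [∀ i, MeasurableSpace (X i)]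
    (μ : ∀ i, Measure (X i)) [∀ i, SigmaFinite (μ i)]
    (hμ : ∀ i, ∃ A B : Set (X i), MeasurableSet A ∧ MeasurableSet B ∧ Disjoint A B ∧
      0 < μ i A ∧ 0 < μ i B)
    {ι : Type*} (T : ι → Finset (Fin p)) (hT : IsConservative T)
    (D : MixedGraph p) (hD : D.IsDAG) :
    (∀ G : MixedGraph p,
      IsPartialEssential μ T D G ∧ AllArrowsProtected T G ↔ G = essentialGraph μ T D) ∧
    (∀ G : MixedGraph p, IsPartialEssential μ T D G →
      ∀ (a b : Fin p) (hab : G.Arrow a b), ¬ StronglyProtected T G a b →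
        IsPartialEssential μ T D (G.addEdge b a hab.ne.symm)) ∧
    (∀ G : MixedGraph p, IsPartialEssential μ T D G →
      (∀ (n : ℕ) (H : MixedGraph p), ReplaceUnprotectedRun T n G H →
        IsPartialEssential μ T D H ∧ n ≤ G.numArrows) ∧
      (∀ H : MixedGraph p, ReplaceUnprotectedReturns T G H ↔ H = essentialGraph μ T D)) := by
  have B : ∀ i, BalancedDensity (μ i) := fun i => by
    choose A B hA _ hAB hA' hB' using hμ
    exact (BalancedDensity.nonempty (hA i) (hA' i).ne'
      ((hB' i).trans_le (measure_mono (hAB i).subset_compl_left)).ne').some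
  have hE : essentialGraph μ T D = D.completedPattern T :=
    essentialGraph_eq_completedPattern B hT hD
  simp only [isPartialEssential_iff hE, hE]
  refine ⟨fun G => ⟨fun h => (h.1.allArrowsProtected_iff hD).1 h.2, ?_⟩,
    fun G hG a b hab hnot => hG.addEdge hD hab hnot,
    fun G hG => ⟨fun n H hrun => ⟨hrun.isPartialPattern hD hG, hrun.le_numArrows⟩,
      fun H => replaceUnprotectedReturns_iff hD hG⟩⟩
  rintro rfl
  have hG := MixedGraph.isPartialPattern_completedPattern (T := T) hD
  exact ⟨hG, (hG.allArrowsProtected_iff hD).2 rfl⟩
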